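/- Let $\triangle ABC$ be a non-degenerate triangle in the plane with labelled vertices, and let $a,b,c$ be its angles at $A,B,C$ respectively, where $a<c$. The \emph{generalized pinwheel subdivision} of $\triangle ABC$ is defined as follows. Let $F$ be the point on $AB$ with $\angle FCB=a$, let $D$ be the point on $AC$ with $\angle DFC=b$, let $E$ be the point on $AB$ with $\angle ADE=b$, and let $G$ be the point on $CF$ with $\angle GDC=a$. This divides $\triangle ABC$ into the five triangles $ADE,\ FDE,\ DFG,\ DCG,\ CBF$. Each of these is again regarded as a triangle with labelled vertices, its first, second and third vertex in this list taking the labels $A,B,C$. (Thus $ADE$, $DFG$, $CBF$ have angles $a,b,c$ in this order and are similar to $\triangle ABC$, while $FDE$ and $DCG$ have angles $a,\,c-a,\,\pi-c$ in this order; in every case the angle at the first vertex is smaller than the angle at the third, so the subdivision can be repeated.) A \emph{generalized pinwheel tiling} of a labelled triangle $T$ is a set of tiles obtained from $\{T\}$ by finitely many (possibly zero) steps, each of which replaces one tile by the five triangles of its subdivision. A tiling $\mathcal T'$ \emph{refines} a tiling $\mathcal T$ if for each tile $\tau$ of $\mathcal T$, either $\tau$ belongs to $\mathcal T'$ or $\mathcal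 T'$ contains all tiles of some generalized pinwheel tiling of $\tau$. Let $\mathrm{Sk}(\mathcal T)$ denote the union of all edges of all tiles of $\mathcal T$, and let $\mathrm{dist}_{\mathrm{Sk}(\mathcal T)}(P,Q)$ be the infimum of the lengths of the paths from $P$ to $Q$ contained in $\mathrm{Sk}(\mathcal T)$. \textbf{Theorem.} Let $T=\triangle ABC$ be a non-degenerate triangle with angles $a,b,c$ at $A,B,C$ such that $a<c$ and $a/\pi$ is irrational. Let $\mathcal T^0,\mathcal T^1,\mathcal T^2,\ldots$ be an infinite sequence of generalized pinwheel tilings of $T$, and let $y_i$ be the maximum diameter of a tile of $\mathcal T^i$. Assume that (a) $\mathcal T^{i+1}$ refines $\mathcal T^i$ for every $i$, and (b) $y_i\to 0$ as $i\to\infty$. Then for any two points $P,Q$ on the boundary of $T$, $$\lim_{i\to\infty}\mathrm{dist}_{\mathrm{Sk}(\mathcal T^i)}(P,Q)=|PQ| .$$ -/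

import Mathlib

open Filter Topology

namespace Pinwheel

open scoped EuclideanGeometry

/-- The Euclidean plane. -/
abbrev Plane : Type := EuclideanSpace ℝ (Fin 2)

/-- A triangle whose vertices are labelled `A`, `B`, `C`. The labels matter: they tell the
subdivision rule which vertex plays which role. -/
@[ext]
structure Tile where
  A : Plane
  B : Plane
  C : Plane

namespace Tile

/-- The three vertices are not collinear. -/
def Nondegenerate (τ : Tile) : Prop := AffineIndependent ℝ ![τ.A, τ.B, τ.C]

/-- The interior angle at `A`. -/
noncomputable def a (τ : Tile) : ℝ := ∠ τ.B τ.A τ.C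

/-- The interior angle at `B`. -/
noncomputable def b (τ : Tile) : ℝ := ∠ τ.A τ.B τ.C

/-- The interior angle at `C`. -/
noncomputable def c (τ : Tile) : ℝ := ∠ τ.A τ.C τ.B

/-- The (closed, filled) triangle. -/
def carrier (τ : Tile) : Set Plane := convexHull ℝ {τ.A, τ.B, τ.C}

/-- The boundary of the triangle: the union of its three sides. -/
def boundary (τ : Tile) : Set Plane :=
  segment ℝ τ.A τ.B ∪ segment ℝ τ.B τ.C ∪ segment ℝ τ.C τ.A

end Tile

/-- `D, E, F, G` are the points of the generalized pinwheel subdivision of the triangle `τ = ABC`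
with angles `a, b, c`: `F` on `AB` with `∠FCB = a`; `D` on `AC` with `∠DFC = b`; `E` on `AB` with
`∠ADE = b`; `G` on `CF` with `∠GDC = a`. -/
structure IsSplitPoints (τ : Tile) (D E F G : Plane) : Prop where
  F_on : Sbtw ℝ τ.A F τ.B
  F_angle : ∠ F τ.C τ.B = τ.a
  D_on : Sbtw ℝ τ.A D τ.C
  D_angle : ∠ D F τ.C = τ.b
  E_on : Sbtw ℝ τ.A E τ.B
  E_angle : ∠ τ.A D E = τ.b
  G_on : Sbtw ℝ τ.C G F
  G_angle : ∠ G D τ.C = τ.a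

/-- The five subtriangles `I, II, III, IV, V`. Each is labelled so that its angles at its vertices
`A, B, C` are, in this order, `a, b, c` for the triangles `I`, `III`, `V` similar to `τ`, and
`a, c - a, π - c` for the two conjugate triangles `II`, `IV`. -/
def children (τ : Tile) (D E F G : Plane) : Set Tile :=
  {⟨τ.A, D, E⟩, ⟨F, D, E⟩, ⟨D, F, G⟩, ⟨D, τ.C, G⟩, ⟨τ.C, τ.B, F⟩}

/-- The generalized pinwheel tilings of `T`: the sets of tiles obtained from `{T}` by finitely many
(possibly zero) steps, each of which replaces one tile by its five subtriangles. -/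
inductive IsTiling (T : Tile) : Set Tile → Prop
  | root : IsTiling T {T}
  | split {𝒯 : Set Tile} {τ : Tile} {D E F G : Plane} :
      IsTiling T 𝒯 → τ ∈ 𝒯 → IsSplitPoints τ D E F G →
        IsTiling T ((𝒯 \ {τ}) ∪ children τ D E F G)

/-- `𝒯'` refines `𝒯`: for each tile `τ` of `𝒯`, either `τ` itself or a generalized pinwheel tiling
of `τ` appears in `𝒯'` (the first case is the trivial tiling `{τ}` of `τ`). -/
def Refines (𝒯' 𝒯 : Set Tile) : Prop :=
  ∀ τ ∈ 𝒯, ∃ 𝒮 : Set Tile, IsTiling τ 𝒮 ∧ 𝒮 ⊆ 𝒯'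

/-- The maximum tile diameter (tilings are finite and nonempty, see `IsTiling.finite` and
`IsTiling.nonempty`, so that the supremum is a maximum). -/
noncomputable def maxDiam (𝒯 : Set Tile) : ℝ :=
  sSup ((fun τ : Tile => Metric.diam τ.carrier) '' 𝒯)

/-- The 1-skeleton: the union of all edges of all tiles. -/
def skeleton (𝒯 : Set Tile) : Set Plane := ⋃ τ ∈ 𝒯, τ.boundary

/-- The length of a shortest path from `P` to `Q` within `S`: the infimum of the lengths of the
continuous paths from `P` to `Q` that stay in `S` (it is `∞` if there is no such path). The length
of a path is its total variation. -/
noncomputable def pathDist (S : Set Plane) (P Q : Plane) : ENNReal :=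
  ⨅ (γ : Path P Q) (_ : ∀ t, γ t ∈ S), eVariationOn γ Set.univ

theorem IsTiling.finite {T : Tile} {𝒯 : Set Tile} (h : IsTiling T 𝒯) : 𝒯.Finite := by
  induction h with
  | root => exact Set.finite_singleton T
  | split _ _ _ ih =>
    refine ih.sdiff.union ?_
    unfold children
    exact Set.toFinite _

theorem IsTiling.nonempty {T : Tile} {𝒯 : Set Tile} (h : IsTiling T 𝒯) : 𝒯.Nonempty := by
  induction h with
  | root => exact Set.singleton_nonempty T
  | split _ _ _ _ => exact Set.Nonempty.inr ⟨_, Set.mem_insert _ _⟩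

end Pinwheel

/-!
The lengths of skeleton paths are at least the Euclidean distance, so the content is the upper
bound. Identify the plane with `ℂ` and describe a triangle by its side `u = B - A` and its shape
`z = (C - A) / (B - A)`. The angle conditions determine the points of the subdivision
(`CTile.eq_of_isSplitPoints`), with coordinates rational in `Re z` and `|z|²`, and the iterated subdivision
produces only the four shapes in `shapes z`. Since the mesh tends to zero, the skeletons eventually
contain the skeleton of the `n`-fold uniform subdivision, for every `n`
(`CTile.eventually_sk_subset`). Hence it suffices to treat uniform subdivisions.

Call `R` a distortion bound (`CTile.Distortion`) if in every tile with one of the four shapes, any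
two points `X`, `Y` of a skeleton are joined in deeper skeletons by paths of length at most
`R |XY| + ε`. Some bound exists (`CTile.exists_distortion`): the boundary of a triangle is
quasi-convex with a constant depending on its angles, and the subdivision is a succession of cuts
along cevians, each of which a chord has to cross in a common point of the two skeletons.

No bound `R > 1` is optimal (`CTile.Distortion.improve`). The tile `DFG` has the shape of the
triangle and is turned by the angle `a`; as `a / π` is irrational, every tile has, at bounded depth,
an edge almost parallel to any given direction (`CTile.exists_edge`). Choose a tile that contains
the midpoint of the chord `XY` and whose size is a small fixed fraction of `|XY|`, and lead the path
along such an edge of it. The edge replaces a piece of the chord that was charged with the factor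
`R`, which saves a multiple of the tile size, while the lateral displacement costs only a
second-order term (`CTile.detour_le`). So the infimum of the distortion bounds is `1`
(`CTile.distortion_one`).
-/

namespace Pinwheel

/-! ### Polygonal paths -/

/-- `Reach S X Y L`: there is a polygonal path from `X` to `Y` inside `S` of length at most `L`. -/
inductive Reach {E : Type*} [NormedAddCommGroup E] [NormedSpace ℝ E] (S : Set E) :
    E → E → ℝ → Prop
  | nil {X : E} {L : ℝ} : X ∈ S → 0 ≤ L → Reach S X X L
  | cons {X Y Z : E} {L L' : ℝ} : segment ℝ X Y ⊆ S → Reach S Y Z L → dist X Y + L ≤ L' →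
      Reach S X Z L'

namespace Reach

variable {E : Type*} [NormedAddCommGroup E] [NormedSpace ℝ E] {S S' : Set E} {X Y Z : E}
  {L L' : ℝ}

theorem mono (h : Reach S X Y L) (hS : S ⊆ S') (hL : L ≤ L') : Reach S' X Y L' := by
  induction h generalizing L' with
  | nil hX h0 => exact nil (hS hX) (h0.trans hL)
  | cons hs _ hle ih => exact cons (hs.trans hS) (ih le_rfl) (hle.trans hL)

theorem nonneg (h : Reach S X Y L) : 0 ≤ L := by
  induction h with
  | nil _ h => exact h
  | cons _ _ hle ih => exact (add_nonneg dist_nonneg ih).trans hle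

theorem trans (h : Reach S X Y L) (h' : Reach S Y Z L') : Reach S X Z (L + L') := by
  induction h with
  | nil hX h0 => exact h'.mono subset_rfl (by linarith)
  | cons hs _ hle ih => exact cons hs (ih h') (by linarith)

theorem of_segment (h : segment ℝ X Y ⊆ S) (hL : dist X Y ≤ L) : Reach S X Y L :=
  cons h (nil (h (right_mem_segment ℝ X Y)) le_rfl) (by linarith)

theorem image {F : Type*} [NormedAddCommGroup F] [NormedSpace ℝ F] (φ : E ≃ₗᵢ[ℝ] F)
    (h : Reach S X Y L) : Reach (φ '' S) (φ X) (φ Y) L := by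
  induction h with
  | nil hX h0 => exact nil (Set.mem_image_of_mem _ hX) h0
  | cons hs _ hle ih =>
    refine cons ?_ ih (by rwa [φ.dist_map])
    have := image_segment ℝ φ.toLinearEquiv.toLinearMap.toAffineMap
    rw [show segment ℝ (φ _) (φ _) = φ '' segment ℝ _ _ from (this _ _).symm]
    exact Set.image_mono hs

end Reach

theorem edist_le_pathDist (S : Set Plane) (P Q : Plane) : edist P Q ≤ pathDist S P Q := by
  refine le_iInf₂ fun γ _ => ?_
  simpa using eVariationOn.edist_le γ (Set.mem_univ (0 : unitInterval)) (Set.mem_univ 1)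

theorem pathDist_mono {S S' : Set Plane} (h : S ⊆ S') (P Q : Plane) :
    pathDist S' P Q ≤ pathDist S P Q :=
  le_iInf₂ fun γ hγ => iInf₂_le_of_le γ (fun t => h (hγ t)) le_rfl

theorem eVariationOn_trans_le {P Q R : Plane} (γ : Path P Q) (γ' : Path Q R) :
    eVariationOn (γ.trans γ') Set.univ ≤
      eVariationOn γ Set.univ + eVariationOn γ' Set.univ := by
  let m : unitInterval := ⟨1 / 2, by norm_num, by norm_num⟩
  have hm := eVariationOn.union (γ.trans γ') (isGreatest_Iic (a := m)) isLeast_Ici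
  rw [Set.Iic_union_Ici] at hm
  rw [hm]
  refine add_le_add ?_ ?_
  · have h : Set.EqOn (γ.trans γ')
        (γ ∘ fun t : unitInterval => Set.projIcc 0 1 zero_le_one (2 * (t : ℝ))) (Set.Iic m) := by
      intro t ht
      have ht' : (t : ℝ) ≤ 1 / 2 := ht
      have h' : (t : ℝ) ≤ 2⁻¹ := by linarith
      simp [Path.trans, h', Path.extend, Set.IccExtend]
    rw [eVariationOn.eq_of_eqOn h]
    refine eVariationOn.comp_le_of_monotoneOn _ _ (fun s _ t _ hst => ?_)
      (fun _ _ => Set.mem_univ _)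
    exact Set.monotone_projIcc _ (by have : (s : ℝ) ≤ t := hst; linarith)
  · have h : Set.EqOn (γ.trans γ')
        (γ' ∘ fun t : unitInterval => Set.projIcc 0 1 zero_le_one (2 * (t : ℝ) - 1))
        (Set.Ici m) := by
      intro t ht
      have ht' : 1 / 2 ≤ (t : ℝ) := ht
      rcases ht'.eq_or_lt with h | h
      · have : t = m := Subtype.ext h.symm
        subst this
        simp [Path.trans_apply, m]
      · have h' : ¬ (t : ℝ) ≤ 2⁻¹ := by linarith
        simp [Path.trans, h', Path.extend, Set.IccExtend]
    rw [eVariationOn.eq_of_eqOn h]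
    refine eVariationOn.comp_le_of_monotoneOn _ _ (fun s _ t _ hst => ?_)
      (fun _ _ => Set.mem_univ _)
    exact Set.monotone_projIcc _ (by have : (s : ℝ) ≤ t := hst; linarith)

theorem pathDist_triangle (S : Set Plane) (P Q R : Plane) :
    pathDist S P R ≤ pathDist S P Q + pathDist S Q R := by
  rw [pathDist, pathDist, pathDist, ENNReal.iInf_add]
  refine le_iInf fun γ => ?_
  rw [ENNReal.iInf_add]
  refine le_iInf fun hγ => ?_
  rw [ENNReal.add_iInf]
  refine le_iInf fun γ' => ?_
  rw [ENNReal.add_iInf]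
  refine le_iInf fun hγ' => ?_
  refine iInf₂_le_of_le (γ.trans γ') (fun t => ?_) (eVariationOn_trans_le γ γ')
  have : γ.trans γ' t ∈ Set.range (γ.trans γ') := ⟨t, rfl⟩
  rw [Path.trans_range] at this
  rcases this with ⟨s, hs⟩ | ⟨s, hs⟩
  · exact hs ▸ hγ s
  · exact hs ▸ hγ' s

theorem pathDist_le_of_segment {S : Set Plane} {P Q : Plane} (h : segment ℝ P Q ⊆ S) :
    pathDist S P Q ≤ edist P Q := by
  let γ : Path P Q :=
    { toFun := fun t => AffineMap.lineMap P Q (t : ℝ)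
      continuous_toFun := by fun_prop
      source' := by simp
      target' := by simp }
  refine iInf₂_le_of_le γ (fun t => h ?_) ?_
  · rw [segment_eq_image_lineMap]
    exact ⟨t, t.2, rfl⟩
  · have hL : LipschitzOnWith (nndist P Q) (AffineMap.lineMap P Q : ℝ → Plane) Set.univ :=
      (lipschitzWith_lineMap P Q).lipschitzOnWith
    have h1 : eVariationOn γ Set.univ ≤
        nndist P Q * eVariationOn (fun t : unitInterval => (t : ℝ)) Set.univ :=
      hL.comp_eVariationOn_le (fun _ _ => Set.mem_univ _)
    have h2 : eVariationOn (fun t : unitInterval => (t : ℝ)) Set.univ ≤ 1 := by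
      have hm : MonotoneOn (fun t : unitInterval => (t : ℝ)) Set.univ := fun _ _ _ _ h => h
      have := (hm.eVariationOn_eq (Set.mem_univ 0) (Set.mem_univ 1)).le
      have hI : (Set.univ ∩ Set.Icc (0 : unitInterval) 1) = Set.univ := by
        ext t; exact ⟨fun _ => trivial, fun _ => ⟨trivial, t.2⟩⟩
      rw [hI] at this
      simpa using this
    calc _ ≤ _ := h1
      _ ≤ nndist P Q * 1 := by gcongr
      _ = edist P Q := by rw [mul_one, edist_nndist]

theorem Reach.pathDist_le {S : Set Plane} {P Q : Plane} {L : ℝ} (h : Reach S P Q L) :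
    pathDist S P Q ≤ ENNReal.ofReal L := by
  induction h with
  | nil hX h0 => 
    refine (pathDist_le_of_segment ?_).trans (by simp)
    simpa using hX
  | @cons X Y Z L L' hs hr hle ih =>
    calc _ ≤ _ := pathDist_triangle S X Y Z
      _ ≤ edist X Y + ENNReal.ofReal L := add_le_add (pathDist_le_of_segment hs) ih
      _ = ENNReal.ofReal (dist X Y + L) := by
        rw [ENNReal.ofReal_add dist_nonneg hr.nonneg, edist_dist]
      _ ≤ _ := ENNReal.ofReal_le_ofReal hle

/-! ### Powers of a complex number with irrational argument -/

/-- A bounded power of `ζ` turns any given number into the direction of the positive real axis, up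
to the angle `arccos ν`: the powers of `ζ` are dense in direction, and the circle is compact. -/
theorem exists_pow_re_ge {ζ : ℂ} (hζ : Irrational (ζ.arg / Real.pi)) {ν : ℝ} (hν : ν < 1) :
    ∃ N : ℕ, ∀ ξ : ℂ, ∃ k ≤ N, ν * ‖ζ ^ k * ξ‖ ≤ (ζ ^ k * ξ).re := by
  have h0 : ζ ≠ 0 := by
    rintro rfl
    simp at hζ
  let α : Real.Angle := (ζ.arg : Real.Angle)
  have : Fact (0 < 2 * Real.pi) := ⟨by positivity⟩
  have : CompactSpace Real.Angle := inferInstanceAs (CompactSpace (AddCircle (2 * Real.pi)))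
  have hd : DenseRange (fun k : ℕ => k • α) := by
    have : DenseRange (fun k : ℤ => k • α) := by
      refine AddCircle.denseRange_zsmul_coe_iff.2 ?_
      have := hζ.div_natCast (m := 2) (by norm_num)
      convert this using 1
      push_cast
      field_simp
    exact denseRange_zsmul_iff_nsmul.1 this
  let U : Set Real.Angle := {θ | ν < θ.cos}
  have hU : IsOpen U := isOpen_lt continuous_const Real.Angle.continuous_cos
  have hU0 : (0 : Real.Angle) ∈ U := by simpa [U] using hν
  obtain ⟨t, ht⟩ := isCompact_univ.elim_finite_subcover
    (fun k : ℕ => {φ : Real.Angle | k • α + φ ∈ U})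
    (fun k => hU.preimage (by fun_prop)) (by
      intro φ _
      obtain ⟨k, hk⟩ := hd.exists_mem_open (s := {θ | θ + φ ∈ U}) (hU.preimage (by fun_prop))
        ⟨-φ, by simpa using hU0⟩
      exact Set.mem_iUnion.2 ⟨k, hk⟩)
  refine ⟨t.sup id, fun ξ => ?_⟩
  obtain ⟨k, hk, hkU⟩ : ∃ k ∈ t, k • α + (ξ.arg : Real.Angle) ∈ U := by
    simpa using ht (Set.mem_univ (ξ.arg : Real.Angle))
  refine ⟨k, Finset.le_sup (f := id) hk, ?_⟩
  rcases eq_or_ne ξ 0 with rfl | hξ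
  · simp
  have harg : ((ζ ^ k * ξ).arg : Real.Angle) = k • α + ξ.arg := by
    rw [Complex.arg_mul_coe_angle (pow_ne_zero _ h0) hξ, Complex.arg_pow_coe_angle]
  have hcos : ν < Real.cos (ζ ^ k * ξ).arg := by
    rw [← Real.Angle.cos_coe, harg]; exact hkU
  rw [← Complex.norm_mul_cos_arg (ζ ^ k * ξ), mul_comm]
  gcongr

/-! ### Cutting a triangle along a cevian -/

section Cevian

variable {E : Type*} [NormedAddCommGroup E] [NormedSpace ℝ E]

theorem mem_convexHull_triple {P Q R X : E} :
    X ∈ convexHull ℝ {P, Q, R} ↔ ∃ x y z : ℝ, 0 ≤ x ∧ 0 ≤ y ∧ 0 ≤ z ∧ x + y + z = 1 ∧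
      x • P + y • Q + z • R = X := by
  constructor
  · intro h
    rw [convexHull_insert ⟨Q, by simp⟩, convexHull_pair, convexJoin_singleton_left] at h
    simp only [Set.mem_iUnion] at h
    obtain ⟨W, ⟨a, b, ha, hb, hab, rfl⟩, c, d, hc, hd, hcd, rfl⟩ := h
    refine ⟨c, d * a, d * b, hc, by positivity, by positivity, ?_, by module⟩
    linear_combination hcd + d * hab
  · rintro ⟨x, y, z, hx, hy, hz, h, rfl⟩
    have hP : P ∈ convexHull ℝ {P, Q, R} := subset_convexHull _ _ (by simp)
    have hQ : Q ∈ convexHull ℝ {P, Q, R} := subset_convexHull _ _ (by simp)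
    have hR : R ∈ convexHull ℝ {P, Q, R} := subset_convexHull _ _ (by simp)
    have := (convex_convexHull ℝ {P, Q, R}).sum_mem (t := Finset.univ) (w := ![x, y, z])
      (z := ![P, Q, R]) (by intro i _; fin_cases i <;> assumption)
      (by simpa [Fin.sum_univ_three] using h) (by intro i _; fin_cases i <;> assumption)
    simpa [Fin.sum_univ_three] using this

/-- A segment joining the two halves of a triangle `PQR` cut by a cevian `PS` meets the cevian. -/
theorem exists_mem_cevian {P Q R S X Y : E} (hS : S ∈ openSegment ℝ Q R)
    (hX : X ∈ convexHull ℝ {P, Q, S}) (hY : Y ∈ convexHull ℝ {P, S, R}) :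
    ∃ Z ∈ segment ℝ P S, Z ∈ segment ℝ X Y := by
  obtain ⟨s', s, hs', hs, hss, rfl⟩ := hS
  obtain ⟨p, q, t, hp, hq, ht, h, rfl⟩ := mem_convexHull_triple.1 hX
  obtain ⟨p', t', r, hp', ht', hr, h', rfl⟩ := mem_convexHull_triple.1 hY
  have hden : 0 ≤ q * s + r * s' := by positivity
  rcases hden.eq_or_lt with h0 | h0
  · have hq0 : q = 0 := by
      have : q * s = 0 := by nlinarith [mul_nonneg hq hs.le, mul_nonneg hr hs'.le]
      simpa [hs.ne'] using this
    subst hq0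
    exact ⟨_, ⟨p, t, hp, ht, by linarith, by module⟩, left_mem_segment _ _ _⟩
  · -- the weights cancel the excess of `Q` over `R` relative to `S`
    refine ⟨_, ?_, r * s' / (q * s + r * s'), q * s / (q * s + r * s'), by positivity,
      by positivity, by field_simp; ring, rfl⟩
    refine ⟨(r * s' * p + q * s * p') / (q * s + r * s'),
      (r * s' * t + q * s * t' + q * r) / (q * s + r * s'), by positivity, by positivity, ?_, ?_⟩
    · field_simp
      linear_combination r * s' * h + q * s * h' - q * r * hss
    · have hs1 : s' = 1 - s := by linarith
      have h0' := h0.ne'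
      match_scalars <;> field_simp <;> ring

theorem convexHull_triple_subset_union {P Q R S : E} (hS : S ∈ openSegment ℝ Q R) :
    convexHull ℝ {P, Q, R} ⊆ convexHull ℝ {P, Q, S} ∪ convexHull ℝ {P, S, R} := by
  obtain ⟨s', s, hs', hs, hss, rfl⟩ := hS
  intro X hX
  obtain ⟨p, q, r, hp, hq, hr, h, rfl⟩ := mem_convexHull_triple.1 hX
  rcases le_total (r * s') (q * s) with hle | hle
  · refine Or.inl (mem_convexHull_triple.2
      ⟨p, q - r * s' / s, r / s, hp, ?_, by positivity, ?_, ?_⟩)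
    · rw [sub_nonneg, div_le_iff₀ hs]; exact hle
    · field_simp
      linear_combination s * h - r * hss
    · match_scalars <;> (field_simp; try ring)
  · refine Or.inr (mem_convexHull_triple.2
      ⟨p, q / s', r - q * s / s', hp, by positivity, ?_, ?_, ?_⟩)
    · rw [sub_nonneg, div_le_iff₀ hs']; exact hle
    · field_simp
      linear_combination s' * h - q * hss
    · match_scalars <;> (field_simp; try ring)

theorem segment_subset_union_of_mem {Q R S : E} (hS : S ∈ openSegment ℝ Q R) :
    segment ℝ Q R ⊆ segment ℝ Q S ∪ segment ℝ S R := by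
  have := convexHull_triple_subset_union (P := S) hS
  rw [← convexHull_pair, ← convexHull_pair, ← convexHull_pair]
  refine (convexHull_mono (Set.subset_insert _ _)).trans (this.trans
    (Set.union_subset_union (convexHull_mono ?_) (convexHull_mono ?_))) <;>
    simp

/-- Any two points of `S` are joined within `S` by a path at most `K` times longer than their
distance. -/
def QuasiConvex (K : ℝ) (S : Set E) : Prop :=
  ∀ X ∈ S, ∀ Y ∈ S, Reach S X Y (K * dist X Y)

theorem QuasiConvex.union {K : ℝ} {P Q R S : E} {S₁ S₂ : Set E}
    (h₁ : QuasiConvex K S₁) (h₂ : QuasiConvex K S₂)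
    (hS : S ∈ openSegment ℝ Q R) (hs₁ : S₁ ⊆ convexHull ℝ {P, Q, S})
    (hs₂ : S₂ ⊆ convexHull ℝ {P, S, R}) (hc₁ : segment ℝ P S ⊆ S₁) (hc₂ : segment ℝ P S ⊆ S₂) :
    QuasiConvex K (S₁ ∪ S₂) := by
  intro X hX Y hY
  rcases hX with hX | hX <;> rcases hY with hY | hY
  · exact (h₁ X hX Y hY).mono Set.subset_union_left le_rfl
  · obtain ⟨Z, hZ, hZXY⟩ := exists_mem_cevian hS (hs₁ hX) (hs₂ hY)
    rw [← dist_add_dist_of_mem_segment hZXY, mul_add]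
    exact ((h₁ X hX Z (hc₁ hZ)).mono Set.subset_union_left le_rfl).trans
      ((h₂ Z (hc₂ hZ) Y hY).mono Set.subset_union_right le_rfl)
  · obtain ⟨Z, hZ, hZXY⟩ := exists_mem_cevian hS (hs₁ hY) (hs₂ hX)
    rw [segment_symm] at hZXY
    rw [← dist_add_dist_of_mem_segment hZXY, mul_add]
    exact ((h₂ X hX Z (hc₂ hZ)).mono Set.subset_union_right le_rfl).trans
      ((h₁ Z (hc₁ hZ) Y hY).mono Set.subset_union_left le_rfl)
  · exact (h₂ X hX Y hY).mono Set.subset_union_right le_rfl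

end Cevian

/-! ### The subdivision in complex coordinates -/

/-- A labelled triangle in the complex plane. -/
@[ext]
structure CTile where
  A : ℂ
  B : ℂ
  C : ℂ

/-- The shapes that the subdivision applies to. A shape is the ratio `z = (C - A) / (B - A)`; the
condition `|z|² < 2 Re z` says that `BC` is shorter than `AB`. -/
def GoodShape (z : ℂ) : Prop := z.im ≠ 0 ∧ Complex.normSq z < 2 * z.re

/-- The ratio `AF / AB` in a triangle of shape `z`. -/
noncomputable def cutF (z : ℂ) : ℝ := 2 * z.re - Complex.normSq z

/-- The ratio `AD / AC` in a triangle of shape `z`. -/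
noncomputable def cutD (z : ℂ) : ℝ := cutF z / (2 * z.re)

namespace CTile

/-- The side `AB` as a vector. -/
def u (t : CTile) : ℂ := t.B - t.A

/-- The similarity class of the triangle (with orientation) as a complex number. -/
noncomputable def z (t : CTile) : ℂ := (t.C - t.A) / (t.B - t.A)

/-- The union of the three sides. -/
def boundary (t : CTile) : Set ℂ :=
  segment ℝ t.A t.B ∪ segment ℝ t.B t.C ∪ segment ℝ t.C t.A

/-- The filled triangle. -/
def carrier (t : CTile) : Set ℂ := convexHull ℝ {t.A, t.B, t.C}

/-- The point `F` of the subdivision, on `AB`. -/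
noncomputable def F (t : CTile) : ℂ := (1 - cutF t.z) • t.A + cutF t.z • t.B

/-- The point `D` of the subdivision, on `AC`. -/
noncomputable def D (t : CTile) : ℂ := (1 - cutD t.z) • t.A + cutD t.z • t.C

/-- The point `E` of the subdivision, on `AF`. -/
noncomputable def E (t : CTile) : ℂ := cutD t.z • t.A + (1 - cutD t.z) • t.F

/-- The point `G` of the subdivision, on `FC`. -/
noncomputable def G (t : CTile) : ℂ := (1 - cutD t.z) • t.F + cutD t.z • t.C

/-- The five tiles of the subdivision. -/
def children (t : CTile) : Set CTile :=
  {⟨t.A, t.D, t.E⟩, ⟨t.F, t.D, t.E⟩, ⟨t.D, t.F, t.G⟩, ⟨t.D, t.C, t.G⟩, ⟨t.C, t.B, t.F⟩}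

/-- The tiles of the `n`-fold uniform subdivision. -/
def desc : ℕ → CTile → Set CTile
  | 0, t => {t}
  | n + 1, t => ⋃ c ∈ t.children, desc n c

/-- The skeleton of the `n`-fold uniform subdivision. -/
def sk (n : ℕ) (t : CTile) : Set ℂ := ⋃ s ∈ t.desc n, s.boundary

theorem sk_zero (t : CTile) : t.sk 0 = t.boundary := by simp [sk, desc]

theorem sk_succ (n : ℕ) (t : CTile) : t.sk (n + 1) = ⋃ c ∈ t.children, c.sk n := by
  simp only [sk, desc, Set.biUnion_iUnion]

end CTile

section Shape

variable {z : ℂ}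

theorem GoodShape.re_pos (h : GoodShape z) : 0 < z.re := by
  have := Complex.normSq_nonneg z
  linarith [h.2]

theorem GoodShape.ne_zero (h : GoodShape z) : z ≠ 0 := by
  rintro rfl
  exact h.1 rfl

theorem GoodShape.cutF_pos (h : GoodShape z) : 0 < cutF z := sub_pos.2 h.2

theorem cutF_eq (z : ℂ) : cutF z = 1 - Complex.normSq (1 - z) := by
  simp only [cutF, Complex.normSq_apply, Complex.sub_re, Complex.sub_im, Complex.one_re,
    Complex.one_im]
  ring

theorem GoodShape.one_sub_ne_zero (h : GoodShape z) : 1 - z ≠ 0 := by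
  intro h0
  apply h.1
  have := congrArg Complex.im h0
  simpa using this

theorem GoodShape.cutF_lt_one (h : GoodShape z) : cutF z < 1 := by
  have := Complex.normSq_pos.2 h.one_sub_ne_zero
  rw [cutF_eq]
  linarith

theorem GoodShape.cutD_pos (h : GoodShape z) : 0 < cutD z :=
  div_pos h.cutF_pos (by linarith [h.re_pos])

theorem GoodShape.cutD_lt_one (h : GoodShape z) : cutD z < 1 := by
  have := Complex.normSq_pos.2 h.ne_zero
  rw [cutD, div_lt_one (by linarith [h.re_pos]), cutF]
  linarith

theorem GoodShape.cutF_eq_mul (h : GoodShape z) :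
    (cutF z : ℂ) = cutD z * (z + (starRingEnd ℂ) z) := by
  rw [Complex.add_conj, ← Complex.ofReal_mul, cutD, div_mul_cancel₀ _ (by linarith [h.re_pos])]

theorem cutF_eq_conj (z : ℂ) :
    (cutF z : ℂ) = z + (starRingEnd ℂ) z - z * (starRingEnd ℂ) z := by
  rw [Complex.add_conj, Complex.mul_conj, cutF]
  push_cast
  ring

theorem cutF_conj (z : ℂ) : cutF ((starRingEnd ℂ) z) = cutF z := by
  simp [cutF]

theorem GoodShape.conj (h : GoodShape z) : GoodShape ((starRingEnd ℂ) z) := by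
  simpa [GoodShape] using h

theorem re_cutF_div (z : ℂ) : ((cutF z : ℂ) / z).re = cutF z * z.re / Complex.normSq z := by
  simp [Complex.div_re]

theorem im_cutF_div (z : ℂ) : ((cutF z : ℂ) / z).im = -(cutF z * z.im / Complex.normSq z) := by
  simp [Complex.div_im]

theorem normSq_cutF_div (z : ℂ) :
    Complex.normSq ((cutF z : ℂ) / z) = cutF z ^ 2 / Complex.normSq z := by
  rw [Complex.normSq_div, Complex.normSq_ofReal, sq]

theorem GoodShape.cutF_div (h : GoodShape z) : GoodShape (cutF z / z) := by
  have hN := Complex.normSq_pos.2 h.ne_zero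
  have hf := h.cutF_pos
  refine ⟨?_, ?_⟩
  · rw [im_cutF_div]
    exact neg_ne_zero.2 (div_ne_zero (mul_ne_zero hf.ne' h.1) hN.ne')
  · rw [normSq_cutF_div, re_cutF_div, ← mul_div_assoc]
    refine div_lt_div_of_pos_right ?_ hN
    have : cutF z < 2 * z.re := by rw [cutF]; linarith
    nlinarith

/-- The conjugate of the conjugate shape is the shape itself, since `cutF` is invariant. -/
theorem GoodShape.cutF_cutF_div (h : GoodShape z) : cutF (cutF z / z) = cutF z := by
  have hN := Complex.normSq_pos.2 h.ne_zero
  have : 2 * (cutF z * z.re / Complex.normSq z) - cutF z ^ 2 / Complex.normSq z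
      = cutF z * (2 * z.re - cutF z) / Complex.normSq z := by ring
  conv_lhs => rw [cutF, normSq_cutF_div, re_cutF_div, this]
  rw [show 2 * z.re - cutF z = Complex.normSq z by rw [cutF]; ring]
  field_simp

/-- The shapes occurring in the iterated subdivision of a triangle of shape `z`: that of the
triangle, that of the conjugate triangle, and their mirror images. -/
def shapes (z : ℂ) : Set ℂ :=
  {z, (starRingEnd ℂ) z, cutF z / z, cutF z / (starRingEnd ℂ) z}

theorem GoodShape.of_mem_shapes (h : GoodShape z) {w : ℂ} (hw : w ∈ shapes z) : GoodShape w := by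
  rcases hw with rfl | rfl | rfl | rfl
  · exact h
  · exact h.conj
  · exact h.cutF_div
  · simpa [cutF_conj] using h.conj.cutF_div

theorem conj_mem_shapes {w : ℂ} (hw : w ∈ shapes z) : (starRingEnd ℂ) w ∈ shapes z := by
  rcases hw with rfl | rfl | rfl | rfl <;> simp [shapes]

theorem GoodShape.cutF_div_mem_shapes (h : GoodShape z) {w : ℂ} (hw : w ∈ shapes z) :
    (cutF w / w : ℂ) ∈ shapes z := by
  have hf : (cutF z : ℂ) ≠ 0 := by exact_mod_cast h.cutF_pos.ne'
  rcases hw with rfl | rfl | rfl | rfl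
  · simp [shapes]
  · simp [shapes, cutF_conj]
  · rw [h.cutF_cutF_div, div_div_cancel₀ hf]
    simp [shapes]
  · have := h.conj.cutF_cutF_div
    rw [cutF_conj] at this
    rw [this, div_div_cancel₀ hf]
    simp [shapes]

end Shape

namespace CTile

variable {t : CTile}

theorem B_eq (t : CTile) : t.B = t.A + t.u := by simp [u]

theorem C_eq (hu : t.u ≠ 0) : t.C = t.A + t.z * t.u := by
  rw [z, ← u, div_mul_cancel₀ _ hu]
  ring

theorem F_eq (t : CTile) : t.F = t.A + cutF t.z * t.u := by
  simp only [F, u, Complex.real_smul]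
  push_cast
  ring

theorem D_eq (hu : t.u ≠ 0) : t.D = t.A + cutD t.z * t.z * t.u := by
  rw [D, C_eq hu]
  simp only [Complex.real_smul]
  push_cast
  ring

theorem E_eq (t : CTile) : t.E = t.A + (1 - cutD t.z) * cutF t.z * t.u := by
  rw [E, F_eq]
  simp only [Complex.real_smul]
  push_cast
  ring

theorem G_eq (hu : t.u ≠ 0) :
    t.G = t.A + ((1 - cutD t.z) * cutF t.z + cutD t.z * t.z) * t.u := by
  rw [G, F_eq, C_eq hu]
  simp only [Complex.real_smul]
  push_cast
  ring

theorem F_mem (h : GoodShape t.z) : t.F ∈ openSegment ℝ t.A t.B :=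
  ⟨_, _, sub_pos.2 h.cutF_lt_one, h.cutF_pos, by ring, rfl⟩

theorem D_mem (h : GoodShape t.z) : t.D ∈ openSegment ℝ t.A t.C :=
  ⟨_, _, sub_pos.2 h.cutD_lt_one, h.cutD_pos, by ring, rfl⟩

theorem E_mem (h : GoodShape t.z) : t.E ∈ openSegment ℝ t.A t.F :=
  ⟨_, _, h.cutD_pos, sub_pos.2 h.cutD_lt_one, by ring, rfl⟩

theorem G_mem (h : GoodShape t.z) : t.G ∈ openSegment ℝ t.F t.C :=
  ⟨_, _, sub_pos.2 h.cutD_lt_one, h.cutD_pos, by ring, rfl⟩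

/-- The sides `AB` and the shapes of the five tiles of the subdivision, in the order `ADE`, `FDE`,
`DFG`, `DCG`, `CBF`. The shape is inverted up to complex conjugation and the positive factor `cutF`
in the two conjugate triangles. -/
theorem u_z_of_mem_children (hu : t.u ≠ 0) (h : GoodShape t.z) {c : CTile} (hc : c ∈ t.children) :
    (c.u = cutD t.z * t.z * t.u ∧ c.z = (starRingEnd ℂ) t.z) ∨
    (c.u = -(cutD t.z * (starRingEnd ℂ) t.z * t.u) ∧ c.z = cutF t.z / (starRingEnd ℂ) t.z) ∨
    (c.u = cutD t.z * (starRingEnd ℂ) t.z * t.u ∧ c.z = t.z) ∨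
    (c.u = (1 - cutD t.z) * t.z * t.u ∧ c.z = cutF t.z / t.z) ∨
    (c.u = (1 - t.z) * t.u ∧ c.z = (starRingEnd ℂ) t.z) := by
  have hd : (cutD t.z : ℂ) ≠ 0 := by exact_mod_cast h.cutD_pos.ne'
  have hd1 : (1 - cutD t.z : ℂ) ≠ 0 := by exact_mod_cast (sub_pos.2 h.cutD_lt_one).ne'
  have hz := h.ne_zero
  have hzc := h.conj.ne_zero
  have h1 := h.one_sub_ne_zero
  have e1 := h.cutF_eq_mul
  have e2 := cutF_eq_conj t.z
  have eF := t.F_eq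
  have eD := D_eq hu
  have eE := t.E_eq
  have eG := G_eq hu
  have eC := C_eq hu
  have eB := t.B_eq
  have euz : ∀ {p q r x y : ℂ}, q - p = x → x ≠ 0 → r - p = y * x →
      (CTile.mk p q r).u = x ∧ (CTile.mk p q r).z = y := by
    intro p q r x y hx hx0 hy
    refine ⟨hx, ?_⟩
    simp only [z]
    rw [hx, hy, mul_div_cancel_right₀ _ hx0]
  generalize (starRingEnd ℂ) t.z = zc at *
  generalize (cutD t.z : ℂ) = d at *
  generalize (cutF t.z : ℂ) = f at *
  rcases hc with rfl | rfl | rfl | rfl | rfl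
  · refine Or.inl (euz (by rw [eD]; ring) (by simp [*]) ?_)
    rw [eE]
    linear_combination (e1 - d * e2) * t.u
  · refine Or.inr (Or.inl (euz ?_ (by simp [*]) ?_))
    · rw [eD, eF]; linear_combination (-e1) * t.u
    · rw [eE, eF]; field_simp; ring
  · refine Or.inr (Or.inr (Or.inl ?_))
    refine euz ?_ (by simp [*]) ?_
    · rw [eD, eF]; linear_combination e1 * t.u
    · rw [eG, eD]; linear_combination (e1 - d * e2) * t.u
  · refine Or.inr (Or.inr (Or.inr (Or.inl (euz ?_ (by simp [*]) ?_))))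
    · rw [eC, eD]; ring
    · rw [eG, eD]; field_simp; ring
  · refine Or.inr (Or.inr (Or.inr (Or.inr (euz ?_ (by simp [*]) ?_))))
    · rw [eC, eB]; ring
    · rw [eF, eC]; linear_combination e2 * t.u

/-- The triangle is nondegenerate and its shape is one of those arising from `z`. -/
def InClass (z : ℂ) (t : CTile) : Prop := t.u ≠ 0 ∧ t.z ∈ shapes z

theorem InClass.child {z : ℂ} (hz : GoodShape z) (ht : t.InClass z) {c : CTile}
    (hc : c ∈ t.children) : c.InClass z := by
  have h := hz.of_mem_shapes ht.2
  have hd : (cutD t.z : ℂ) ≠ 0 := by exact_mod_cast h.cutD_pos.ne'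
  have hd1 : (1 - cutD t.z : ℂ) ≠ 0 := by exact_mod_cast (sub_pos.2 h.cutD_lt_one).ne'
  have hz' := h.ne_zero
  have h1 := h.one_sub_ne_zero
  have hu := ht.1
  rcases u_z_of_mem_children ht.1 h hc with ⟨e, e'⟩ | ⟨e, e'⟩ | ⟨e, e'⟩ | ⟨e, e'⟩ | ⟨e, e'⟩ <;>
    rw [InClass, e, e'] <;> refine ⟨by simp [*], ?_⟩
  · exact conj_mem_shapes ht.2
  · simpa [cutF_conj] using hz.cutF_div_mem_shapes (conj_mem_shapes ht.2)
  · exact ht.2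
  · exact hz.cutF_div_mem_shapes ht.2
  · exact conj_mem_shapes ht.2


/-! ### Skeletons of the uniform subdivisions -/

variable {c s : CTile} {z : ℂ}

theorem mem_carrier (t : CTile) : t.A ∈ t.carrier ∧ t.B ∈ t.carrier ∧ t.C ∈ t.carrier :=
  ⟨subset_convexHull _ _ (by simp), subset_convexHull _ _ (by simp),
    subset_convexHull _ _ (by simp)⟩

theorem boundary_subset_carrier (t : CTile) : t.boundary ⊆ t.carrier := by
  have hc : Convex ℝ t.carrier := convex_convexHull _ _
  obtain ⟨hA, hB, hC⟩ := t.mem_carrier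
  exact Set.union_subset (Set.union_subset (hc.segment_subset hA hB) (hc.segment_subset hB hC))
    (hc.segment_subset hC hA)

theorem D_mem_carrier (h : GoodShape t.z) : t.D ∈ t.carrier := by
  obtain ⟨hA, hB, hC⟩ := t.mem_carrier
  exact (convex_convexHull ℝ _).segment_subset hA hC (openSegment_subset_segment _ _ _ (D_mem h))

theorem F_mem_carrier (h : GoodShape t.z) : t.F ∈ t.carrier := by
  obtain ⟨hA, hB, hC⟩ := t.mem_carrier
  exact (convex_convexHull ℝ _).segment_subset hA hB (openSegment_subset_segment _ _ _ (F_mem h))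

theorem E_mem_carrier (h : GoodShape t.z) : t.E ∈ t.carrier :=
  (convex_convexHull ℝ _).segment_subset t.mem_carrier.1 (F_mem_carrier h)
    (openSegment_subset_segment _ _ _ (E_mem h))

theorem G_mem_carrier (h : GoodShape t.z) : t.G ∈ t.carrier :=
  (convex_convexHull ℝ _).segment_subset (F_mem_carrier h) t.mem_carrier.2.2
    (openSegment_subset_segment _ _ _ (G_mem h))

theorem carrier_child_subset (h : GoodShape t.z) (hc : c ∈ t.children) :
    c.carrier ⊆ t.carrier := by
  obtain ⟨hA, hB, hC⟩ := t.mem_carrier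
  have hD := D_mem_carrier h
  have hE := E_mem_carrier h
  have hF := F_mem_carrier h
  have hG := G_mem_carrier h
  refine convexHull_min ?_ (convex_convexHull _ _)
  rcases hc with rfl | rfl | rfl | rfl | rfl <;> simp [Set.insert_subset_iff, *]

/-- A triangle is covered by the five tiles of its subdivision. -/
theorem exists_child_mem (h : GoodShape t.z) {X : ℂ} (hX : X ∈ t.carrier) :
    ∃ c ∈ t.children, X ∈ c.carrier := by
  have perm : ∀ {P Q R P' Q' R' : ℂ}, X ∈ convexHull ℝ {P, Q, R} →
      ({P, Q, R} : Set ℂ) ⊆ {P', Q', R'} → X ∈ convexHull ℝ {P', Q', R'} :=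
    fun h hs => convexHull_mono hs h
  have hX' : X ∈ convexHull ℝ {t.C, t.A, t.B} := perm hX (by simp [Set.insert_subset_iff])
  rcases convexHull_triple_subset_union (F_mem h) hX' with h1 | h1
  · have h1' : X ∈ convexHull ℝ {t.F, t.A, t.C} := perm h1 (by simp [Set.insert_subset_iff])
    rcases convexHull_triple_subset_union (D_mem h) h1' with h2 | h2
    · have h2' : X ∈ convexHull ℝ {t.D, t.A, t.F} := perm h2 (by simp [Set.insert_subset_iff])
      rcases convexHull_triple_subset_union (E_mem h) h2' with h3 | h3
      · exact ⟨⟨t.A, t.D, t.E⟩, by simp [children], perm h3 (by simp [Set.insert_subset_iff])⟩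
      · exact ⟨⟨t.F, t.D, t.E⟩, by simp [children], perm h3 (by simp [Set.insert_subset_iff])⟩
    · have h2' : X ∈ convexHull ℝ {t.D, t.F, t.C} := perm h2 (by simp [Set.insert_subset_iff])
      rcases convexHull_triple_subset_union (G_mem h) h2' with h3 | h3
      · exact ⟨⟨t.D, t.F, t.G⟩, by simp [children], h3⟩
      · exact ⟨⟨t.D, t.C, t.G⟩, by simp [children], perm h3 (by simp [Set.insert_subset_iff])⟩
  · exact ⟨⟨t.C, t.B, t.F⟩, by simp [children], perm h1 (by simp [Set.insert_subset_iff])⟩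

theorem segments_subset_boundary (A B C : ℂ) :
    (segment ℝ A B ⊆ (CTile.mk A B C).boundary ∧ segment ℝ B A ⊆ (CTile.mk A B C).boundary) ∧
    (segment ℝ B C ⊆ (CTile.mk A B C).boundary ∧ segment ℝ C B ⊆ (CTile.mk A B C).boundary) ∧
    (segment ℝ C A ⊆ (CTile.mk A B C).boundary ∧ segment ℝ A C ⊆ (CTile.mk A B C).boundary) := by
  rw [segment_symm ℝ B A, segment_symm ℝ C B, segment_symm ℝ A C]
  simp only [and_self, boundary]
  exact ⟨fun _ h => Or.inl (Or.inl h), fun _ h => Or.inl (Or.inr h), fun _ h => Or.inr h⟩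

/-- The sides of a triangle are covered by the sides of the tiles of its subdivision. -/
theorem boundary_subset_children (h : GoodShape t.z) :
    t.boundary ⊆ ⋃ c ∈ t.children, c.boundary := by
  have key : ∀ c ∈ t.children, c.boundary ⊆ ⋃ c ∈ t.children, c.boundary :=
    fun c hc => Set.subset_biUnion_of_mem (u := fun c : CTile => c.boundary) hc
  have hI := key ⟨t.A, t.D, t.E⟩ (by simp [children])
  have hII := key ⟨t.F, t.D, t.E⟩ (by simp [children])
  have hIV := key ⟨t.D, t.C, t.G⟩ (by simp [children])
  have hV := key ⟨t.C, t.B, t.F⟩ (by simp [children])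
  refine Set.union_subset (Set.union_subset ?_ ?_) ?_
  · refine (segment_subset_union_of_mem (F_mem h)).trans (Set.union_subset
      ((segment_subset_union_of_mem (E_mem h)).trans (Set.union_subset ?_ ?_)) ?_)
    · exact (segments_subset_boundary _ _ _).2.2.2.trans hI
    · exact (segments_subset_boundary _ _ _).2.2.1.trans hII
    · exact (segments_subset_boundary _ _ _).2.1.2.trans hV
  · exact (segments_subset_boundary _ _ _).1.2.trans hV
  · rw [segment_symm]
    refine (segment_subset_union_of_mem (D_mem h)).trans (Set.union_subset ?_ ?_)
    · exact (segments_subset_boundary _ _ _).1.1.trans hI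
    · exact (segments_subset_boundary _ _ _).1.1.trans hIV

theorem InClass.good (hz : GoodShape z) (ht : t.InClass z) : GoodShape t.z :=
  hz.of_mem_shapes ht.2

theorem InClass.desc (hz : GoodShape z) {n : ℕ} (ht : t.InClass z) (hs : s ∈ t.desc n) :
    s.InClass z := by
  induction n generalizing t with
  | zero => rw [CTile.desc, Set.mem_singleton_iff] at hs; exact hs ▸ ht
  | succ n ih =>
    simp only [CTile.desc, Set.mem_iUnion] at hs
    obtain ⟨c, hc, hs⟩ := hs
    exact ih (ht.child hz hc) hs

theorem carrier_desc_subset (hz : GoodShape z) {n : ℕ} (ht : t.InClass z) (hs : s ∈ t.desc n) :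
    s.carrier ⊆ t.carrier := by
  induction n generalizing t with
  | zero => rw [CTile.desc, Set.mem_singleton_iff] at hs; rw [hs]
  | succ n ih =>
    simp only [CTile.desc, Set.mem_iUnion] at hs
    obtain ⟨c, hc, hs⟩ := hs
    exact (ih (ht.child hz hc) hs).trans (carrier_child_subset (ht.good hz) hc)

theorem sk_subset_carrier (hz : GoodShape z) (ht : t.InClass z) (n : ℕ) :
    t.sk n ⊆ t.carrier :=
  Set.iUnion₂_subset fun s hs =>
    s.boundary_subset_carrier.trans (carrier_desc_subset hz ht hs)

theorem boundary_subset_sk (hz : GoodShape z) (ht : t.InClass z) (n : ℕ) :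
    t.boundary ⊆ t.sk n := by
  induction n generalizing t with
  | zero => rw [sk_zero]
  | succ n ih =>
    rw [sk_succ]
    exact (boundary_subset_children (ht.good hz)).trans
      (Set.iUnion₂_mono fun c hc => ih (ht.child hz hc))

theorem sk_mono (hz : GoodShape z) (ht : t.InClass z) {m n : ℕ} (h : m ≤ n) :
    t.sk m ⊆ t.sk n := by
  induction m generalizing t n with
  | zero => rw [sk_zero]; exact boundary_subset_sk hz ht n
  | succ m ih =>
    obtain ⟨n, rfl⟩ : ∃ k, n = k + 1 := ⟨n - 1, by omega⟩
    rw [sk_succ, sk_succ]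
    exact Set.iUnion₂_mono fun c hc => ih (ht.child hz hc) (by omega)

theorem sk_desc_subset {n : ℕ} (hs : s ∈ t.desc n) (m : ℕ) : s.sk m ⊆ t.sk (n + m) := by
  induction n generalizing t with
  | zero => rw [CTile.desc, Set.mem_singleton_iff] at hs; simp [hs]
  | succ n ih =>
    simp only [CTile.desc, Set.mem_iUnion] at hs
    obtain ⟨c, hc, hs⟩ := hs
    rw [show n + 1 + m = (n + m) + 1 by ring, sk_succ]
    exact (ih hs).trans (Set.subset_biUnion_of_mem (u := fun c : CTile => c.sk (n + m)) hc)

/-- Quasi-convexity passes from the tiles to the skeleton of the subdivided triangle: the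
subdivision consists of four successive cuts along the cevians `CF`, `FD`, `DE`, `DG`. -/
theorem quasiConvex_children (h : GoodShape t.z) {K : ℝ} {S : CTile → Set ℂ}
    (hS : ∀ c ∈ t.children, QuasiConvex K (S c)) (hb : ∀ c ∈ t.children, c.boundary ⊆ S c)
    (hc : ∀ c ∈ t.children, S c ⊆ c.carrier) :
    QuasiConvex K (⋃ c ∈ t.children, S c) := by
  have e : (⋃ c ∈ t.children, S c) = ((S ⟨t.A, t.D, t.E⟩ ∪ S ⟨t.F, t.D, t.E⟩) ∪
      (S ⟨t.D, t.F, t.G⟩ ∪ S ⟨t.D, t.C, t.G⟩)) ∪ S ⟨t.C, t.B, t.F⟩ := by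
    simp only [children, Set.biUnion_insert, Set.biUnion_singleton, Set.union_assoc]
  have h1 : (⟨t.A, t.D, t.E⟩ : CTile) ∈ t.children := by simp [children]
  have h2 : (⟨t.F, t.D, t.E⟩ : CTile) ∈ t.children := by simp [children]
  have h3 : (⟨t.D, t.F, t.G⟩ : CTile) ∈ t.children := by simp [children]
  have h4 : (⟨t.D, t.C, t.G⟩ : CTile) ∈ t.children := by simp [children]
  have h5 : (⟨t.C, t.B, t.F⟩ : CTile) ∈ t.children := by simp [children]
  have perm : ∀ {P Q R P' Q' R' : ℂ}, ({P, Q, R} : Set ℂ) ⊆ {P', Q', R'} →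
      convexHull ℝ {P, Q, R} ⊆ convexHull ℝ {P', Q', R'} := fun hs => convexHull_mono hs
  have cut : ∀ {P Q R X : ℂ} {U V : Set ℂ}, X ∈ openSegment ℝ Q R → U ⊆ convexHull ℝ {P, Q, X} →
      V ⊆ convexHull ℝ {P, X, R} → U ∪ V ⊆ convexHull ℝ {P, Q, R} := by
    intro P Q R X U V hX hU hV
    have hX' : X ∈ convexHull ℝ {P, Q, R} := by
      refine (convex_convexHull ℝ {P, Q, R}).segment_subset ?_ ?_
        (openSegment_subset_segment _ _ _ hX) <;> exact subset_convexHull _ _ (by simp)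
    have hP : ∀ Y ∈ ({P, Q, R} : Set ℂ), Y ∈ convexHull ℝ {P, Q, R} := subset_convexHull _ _
    refine Set.union_subset (hU.trans (convexHull_min ?_ (convex_convexHull _ _)))
      (hV.trans (convexHull_min ?_ (convex_convexHull _ _))) <;>
      simp [Set.insert_subset_iff, hX', hP]
  have c1 : S ⟨t.A, t.D, t.E⟩ ⊆ convexHull ℝ {t.D, t.A, t.E} :=
    (hc _ h1).trans (perm (by simp [Set.insert_subset_iff]))
  have c2 : S ⟨t.F, t.D, t.E⟩ ⊆ convexHull ℝ {t.D, t.E, t.F} :=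
    (hc _ h2).trans (perm (by simp [Set.insert_subset_iff]))
  have c3 : S ⟨t.D, t.F, t.G⟩ ⊆ convexHull ℝ {t.D, t.F, t.G} := hc _ h3
  have c4 : S ⟨t.D, t.C, t.G⟩ ⊆ convexHull ℝ {t.D, t.G, t.C} :=
    (hc _ h4).trans (perm (by simp [Set.insert_subset_iff]))
  have c12 : S ⟨t.A, t.D, t.E⟩ ∪ S ⟨t.F, t.D, t.E⟩ ⊆ convexHull ℝ {t.F, t.A, t.D} :=
    (cut (E_mem h) c1 c2).trans (perm (by simp [Set.insert_subset_iff]))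
  have c34 : S ⟨t.D, t.F, t.G⟩ ∪ S ⟨t.D, t.C, t.G⟩ ⊆ convexHull ℝ {t.F, t.D, t.C} :=
    (cut (G_mem h) c3 c4).trans (perm (by simp [Set.insert_subset_iff]))
  have c1234 := (cut (D_mem h) c12 c34).trans
    (perm (P' := t.C) (Q' := t.A) (R' := t.F) (by simp [Set.insert_subset_iff]))
  have c5 : S ⟨t.C, t.B, t.F⟩ ⊆ convexHull ℝ {t.C, t.F, t.B} :=
    (hc _ h5).trans (perm (by simp [Set.insert_subset_iff]))
  have q12 := (hS _ h1).union (hS _ h2) (E_mem h) c1 c2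
    ((segments_subset_boundary _ _ _).2.1.1.trans (hb _ h1))
    ((segments_subset_boundary _ _ _).2.1.1.trans (hb _ h2))
  have q34 := (hS _ h3).union (hS _ h4) (G_mem h) c3 c4
    ((segments_subset_boundary _ _ _).2.2.2.trans (hb _ h3))
    ((segments_subset_boundary _ _ _).2.2.2.trans (hb _ h4))
  have q1234 := q12.union q34 (D_mem h) c12 c34
    (((segments_subset_boundary _ _ _).1.1.trans (hb _ h2)).trans Set.subset_union_right)
    (((segments_subset_boundary _ _ _).1.2.trans (hb _ h3)).trans Set.subset_union_left)
  rw [e]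
  refine q1234.union (hS _ h5) (F_mem h) c1234 c5 ?_
    ((segments_subset_boundary _ _ _).2.2.2.trans (hb _ h5))
  rw [segment_symm]
  refine (segment_subset_union_of_mem (G_mem h)).trans (Set.union_subset ?_ ?_)
  · exact (((segments_subset_boundary _ _ _).2.1.1.trans (hb _ h3)).trans
      Set.subset_union_left).trans Set.subset_union_right
  · exact (((segments_subset_boundary _ _ _).2.1.2.trans (hb _ h4)).trans
      Set.subset_union_right).trans Set.subset_union_right

/-- A quasi-convexity constant for the boundaries of all tiles of the class is one for all
skeletons, at every depth. -/
theorem quasiConvex_sk (hz : GoodShape z) {K : ℝ}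
    (hK : ∀ t : CTile, t.InClass z → QuasiConvex K t.boundary) (n : ℕ) (ht : t.InClass z) :
    QuasiConvex K (t.sk n) := by
  induction n generalizing t with
  | zero => rw [sk_zero]; exact hK t ht
  | succ n ih =>
    rw [sk_succ]
    exact quasiConvex_children (ht.good hz) (fun c hc => ih (ht.child hz hc))
      (fun c hc => boundary_subset_sk hz (ht.child hz hc) n)
      (fun c hc => sk_subset_carrier hz (ht.child hz hc) n)

/-! ### The boundary of a triangle is quasi-convex -/

/-- Walking around a corner of a triangle costs at most a factor controlled by the angle. -/
theorem dist_corner_le {P Q R X Y : ℂ} (hX : X ∈ segment ℝ P Q) (hY : Y ∈ segment ℝ P R) {κ : ℝ}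
    (hκ : ‖Q - P‖ * ‖R - P‖ ≤ κ * |((Q - P) * (starRingEnd ℂ) (R - P)).im|)
    (h0 : ((Q - P) * (starRingEnd ℂ) (R - P)).im ≠ 0) :
    dist X P + dist P Y ≤ 2 * κ * dist X Y := by
  rw [segment_eq_image'] at hX hY
  obtain ⟨x, ⟨hx, -⟩, rfl⟩ := hX
  obtain ⟨y, ⟨hy, -⟩, rfl⟩ := hY
  simp only [dist_eq_norm, add_sub_cancel_left, sub_add_cancel_left, norm_neg,
    add_sub_add_left_eq_sub, Complex.real_smul, norm_mul, Complex.norm_real, Real.norm_eq_abs,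
    abs_of_nonneg hx, abs_of_nonneg hy]
  generalize Q - P = p at *
  generalize R - P = q at *
  set I := |(p * (starRingEnd ℂ) q).im| with hI
  have hIpos : 0 < I := abs_pos.2 h0
  have e1 : x * I ≤ ‖(x : ℂ) * p - y * q‖ * ‖q‖ := by
    have := Complex.abs_im_le_norm (((x : ℂ) * p - y * q) * (starRingEnd ℂ) q)
    rw [norm_mul, Complex.norm_conj] at this
    refine le_trans (le_of_eq ?_) this
    rw [hI, ← abs_of_nonneg hx, ← abs_mul, abs_of_nonneg hx]
    congr 1
    simp
    ring
  have e2 : y * I ≤ ‖(x : ℂ) * p - y * q‖ * ‖p‖ := by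
    have := Complex.abs_im_le_norm (((x : ℂ) * p - y * q) * (starRingEnd ℂ) p)
    rw [norm_mul, Complex.norm_conj] at this
    refine le_trans (le_of_eq ?_) this
    rw [hI, ← abs_of_nonneg hy, ← abs_mul, abs_of_nonneg hy]
    congr 1
    simp
    ring
  have hN := norm_nonneg ((x : ℂ) * p - y * q)
  refine le_of_mul_le_mul_right ?_ hIpos
  nlinarith [mul_le_mul_of_nonneg_left hκ hN, mul_le_mul_of_nonneg_right e1 (norm_nonneg p),
    mul_le_mul_of_nonneg_right e2 (norm_nonneg q)]

theorem quasiConvex_boundary (h : GoodShape t.z) (hu : t.u ≠ 0) {K : ℝ}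
    (hK : 2 * ((1 + ‖t.z‖) / |t.z.im|) ≤ K) : QuasiConvex K t.boundary := by
  set κ := (1 + ‖t.z‖) / |t.z.im| with hκ
  have him : 0 < |t.z.im| := abs_pos.2 h.1
  have hκ1 : 1 ≤ κ := by
    rw [hκ, one_le_div him]
    linarith [Complex.abs_im_le_norm t.z]
  have hun : 0 < ‖t.u‖ := norm_pos_iff.2 hu
  have h1z : ‖1 - t.z‖ ≤ 1 := by
    have := h.cutF_pos
    rw [cutF_eq, Complex.normSq_eq_norm_sq] at this
    nlinarith [norm_nonneg (1 - t.z)]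
  have hcorner : ∀ {P Q R p q : ℂ}, Q - P = p * t.u → R - P = q * t.u → ‖p‖ * ‖q‖ ≤ 1 + ‖t.z‖ →
      |(p * (starRingEnd ℂ) q).im| = |t.z.im| → segment ℝ P Q ⊆ t.boundary →
      segment ℝ P R ⊆ t.boundary → ∀ X ∈ segment ℝ P Q, ∀ Y ∈ segment ℝ P R,
      Reach t.boundary X Y (K * dist X Y) ∧ Reach t.boundary Y X (K * dist Y X) := by
    intro P Q R p q hp hq hpq hI hsQ hsR X hX Y hY
    have e : ((Q - P) * (starRingEnd ℂ) (R - P)).im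
        = ‖t.u‖ ^ 2 * (p * (starRingEnd ℂ) q).im := by
      rw [hp, hq, ← Complex.im_ofReal_mul, ← Complex.normSq_eq_norm_sq, ← Complex.mul_conj, map_mul]
      congr 1
      ring
    have hle := dist_corner_le hX hY (κ := κ) (by
        rw [e, abs_mul, hI, hp, hq, norm_mul, norm_mul, abs_of_nonneg (by positivity), hκ]
        rw [div_mul_eq_mul_div, le_div_iff₀ him]
        have : 0 ≤ ‖t.u‖ ^ 2 * |t.z.im| := by positivity
        nlinarith) (by
        rw [e]
        exact mul_ne_zero (by positivity) (abs_pos.1 (hI ▸ him)))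
    have hle' : dist X P + dist P Y ≤ K * dist X Y :=
      hle.trans (mul_le_mul_of_nonneg_right hK dist_nonneg)
    have sX : segment ℝ X P ⊆ t.boundary :=
      ((convex_segment P Q).segment_subset hX (left_mem_segment _ _ _)).trans hsQ
    have sY : segment ℝ P Y ⊆ t.boundary :=
      ((convex_segment P R).segment_subset (left_mem_segment _ _ _) hY).trans hsR
    refine ⟨((Reach.of_segment sX le_rfl).trans (Reach.of_segment sY le_rfl)).mono subset_rfl hle',
      ((Reach.of_segment (X := Y) (Y := P) ?_ le_rfl).trans
        (Reach.of_segment (X := P) (Y := X) ?_ le_rfl)).mono subset_rfl ?_⟩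
    · rwa [segment_symm]
    · rwa [segment_symm]
    · rw [dist_comm Y P, dist_comm P X, dist_comm Y X]; linarith
  have hside : ∀ {P Q : ℂ}, segment ℝ P Q ⊆ t.boundary → ∀ X ∈ segment ℝ P Q,
      ∀ Y ∈ segment ℝ P Q, Reach t.boundary X Y (K * dist X Y) := fun hs X hX Y hY =>
    Reach.of_segment (((convex_segment _ _).segment_subset hX hY).trans hs)
      (by nlinarith [dist_nonneg (x := X) (y := Y)])
  have hC := C_eq hu
  have hB := t.B_eq
  obtain ⟨⟨sAB, sBA⟩, ⟨sBC, sCB⟩, sCA, sAC⟩ := segments_subset_boundary t.A t.B t.C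
  have cA := hcorner (P := t.A) (Q := t.B) (R := t.C) (p := 1) (q := t.z)
    (by rw [hB]; ring) (by rw [hC]; ring) (by simp) (by simp) sAB sAC
  have cB := hcorner (P := t.B) (Q := t.A) (R := t.C) (p := -1) (q := -(1 - t.z))
    (by rw [hB]; ring) (by rw [hC, hB]; ring)
    (by rw [norm_neg, norm_neg, norm_one]; linarith [norm_nonneg t.z])
    (by simp) sBA sBC
  have cC := hcorner (P := t.C) (Q := t.A) (R := t.B) (p := -t.z) (q := 1 - t.z)
    (by rw [hC]; ring) (by rw [hC, hB]; ring)
    (by rw [norm_neg]; nlinarith [norm_nonneg t.z])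
    (by rw [← abs_neg]; congr 1; simp; ring) sCA sCB
  intro X hX Y hY
  rcases hX with (hX | hX) | hX <;> rcases hY with (hY | hY) | hY
  · exact hside sAB X hX Y hY
  · exact (cB X (segment_symm ℝ t.A t.B ▸ hX) Y hY).1
  · exact (cA X hX Y (segment_symm ℝ t.A t.C ▸ hY)).1
  · exact (cB Y (segment_symm ℝ t.A t.B ▸ hY) X hX).2
  · exact hside sBC X hX Y hY
  · exact (cC Y hY X (segment_symm ℝ t.B t.C ▸ hX)).2
  · exact (cA Y hY X (segment_symm ℝ t.A t.C ▸ hX)).2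
  · exact (cC X hX Y (segment_symm ℝ t.B t.C ▸ hY)).1
  · exact hside sCA X hX Y hY


/-! ### Uniform bounds for the descendants of a tile -/

theorem finite_shapes (z : ℂ) : (shapes z).Finite := by
  unfold shapes
  exact Set.toFinite _

theorem exists_pos_le_of_finite {α : Type*} {S : Set α} (hS : S.Finite) {g : α → ℝ}
    (hg : ∀ x ∈ S, 0 < g x) : ∃ κ > 0, ∀ x ∈ S, κ ≤ g x := by
  rcases S.eq_empty_or_nonempty with rfl | hne
  · exact ⟨1, one_pos, by simp⟩
  · obtain ⟨x, hx, h⟩ := S.exists_min_image g hS hne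
    exact ⟨g x, hg x hx, h⟩

/-- Twice the area of the triangle. -/
noncomputable def area (t : CTile) : ℝ := Complex.normSq t.u * |t.z.im|

theorem InClass.area_pos (hz : GoodShape z) (ht : t.InClass z) : 0 < t.area :=
  mul_pos (Complex.normSq_pos.2 ht.1) (abs_pos.2 (ht.good hz).1)

/-- Diameters are controlled by areas, since only finitely many shapes occur. -/
theorem exists_dist_le_sqrt_area (hz : GoodShape z) : ∃ H > 0, ∀ t : CTile, t.InClass z →
    ∀ X ∈ t.carrier, ∀ Y ∈ t.carrier, dist X Y ≤ H * √t.area := by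
  obtain ⟨M, hM⟩ := ((finite_shapes z).image fun w => 2 * (1 + ‖w‖) / √|w.im|).bddAbove
  refine ⟨max M 1, by positivity, fun t ht X hX Y hY => ?_⟩
  have hm := hM (Set.mem_image_of_mem _ ht.2)
  have him : 0 < |t.z.im| := abs_pos.2 (ht.good hz).1
  have hball : t.carrier ⊆ Metric.closedBall t.A ((1 + ‖t.z‖) * ‖t.u‖) := by
    refine convexHull_min ?_ (convex_closedBall _ _)
    have h0 := norm_nonneg t.z
    have h1 := norm_nonneg t.u
    simp only [Set.insert_subset_iff, Set.singleton_subset_iff, Metric.mem_closedBall,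
      dist_eq_norm]
    refine ⟨by simp; positivity, ?_, ?_⟩
    · change ‖t.u‖ ≤ _
      nlinarith
    · rw [C_eq ht.1, add_sub_cancel_left, norm_mul]
      nlinarith
  have hsq : √t.area = ‖t.u‖ * √|t.z.im| := by
    rw [area, Complex.normSq_eq_norm_sq, Real.sqrt_mul (by positivity),
      Real.sqrt_sq (norm_nonneg _)]
  have hX' : dist X t.A ≤ _ := hball hX
  have hY' : dist Y t.A ≤ _ := hball hY
  calc dist X Y ≤ dist X t.A + dist Y t.A := dist_triangle_right _ _ _
    _ ≤ 2 * (1 + ‖t.z‖) * ‖t.u‖ := by linarith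
    _ = 2 * (1 + ‖t.z‖) / √|t.z.im| * √t.area := by
        rw [hsq]
        field_simp
    _ ≤ max M 1 * √t.area := by
        gcongr
        exact hm.trans (le_max_left _ _)

/-- The subdivision shrinks areas by factors bounded away from `0` and `1`. -/
theorem exists_area_child (hz : GoodShape z) : ∃ κ > 0, κ ≤ 1 ∧ ∀ t : CTile, t.InClass z →
    ∀ c ∈ t.children, κ * t.area ≤ c.area ∧ c.area ≤ (1 - κ) * t.area := by
  obtain ⟨κ, hκ, h⟩ := exists_pos_le_of_finite (finite_shapes z)
    (g := fun w => min (min (cutD w * (1 - cutD w) * cutF w) (cutD w ^ 2 * cutF w))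
      (min ((1 - cutD w) ^ 2 * cutF w) (1 - cutF w))) (by
      intro w hw
      have hw := hz.of_mem_shapes hw
      have h1 := hw.cutD_pos
      have h2 := sub_pos.2 hw.cutD_lt_one
      have h3 := hw.cutF_pos
      have h4 := sub_pos.2 hw.cutF_lt_one
      exact lt_min (lt_min (by positivity) (by positivity)) (lt_min (by positivity) h4))
  -- the five areas are bounded below by `κ` and add up to `1`, hence are at most `1 - κ`
  have key : ∀ t : CTile, t.InClass z →
    ∀ c ∈ t.children, κ * t.area ≤ c.area ∧ c.area ≤ (1 - κ) * t.area := by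
    intro t ht c hc
    have hg := ht.good hz
    have hb := h _ ht.2
    simp only [le_inf_iff] at hb
    obtain ⟨⟨b1, b2⟩, b3, b4⟩ := hb
    have hf := hg.cutF_pos
    have hN := Complex.normSq_pos.2 hg.ne_zero
    have hd := hg.cutD_pos
    have hdN : cutD t.z * Complex.normSq t.z = (1 - cutD t.z) * cutF t.z := by
      have : cutF t.z = cutD t.z * (2 * t.z.re) := by
        rw [cutD, div_mul_cancel₀ _ (by linarith [hg.re_pos])]
      have h' : cutF t.z = 2 * t.z.re - Complex.normSq t.z := rfl
      linear_combination cutD t.z * h' - this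
    have hA : 0 ≤ t.area := (ht.area_pos hz).le
    have red : ∀ {r : ℝ}, κ ≤ r → r ≤ 1 - κ → c.area = r * t.area →
        κ * t.area ≤ c.area ∧ c.area ≤ (1 - κ) * t.area := by
      rintro r h1 h2 e
      rw [e]
      exact ⟨mul_le_mul_of_nonneg_right h1 hA, mul_le_mul_of_nonneg_right h2 hA⟩
    have hns : ∀ r : ℝ, Complex.normSq ((r : ℂ) * t.z * t.u)
        = r ^ 2 * Complex.normSq t.z * Complex.normSq t.u := by
      intro r; rw [map_mul, map_mul, Complex.normSq_ofReal]; ring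
    have hns' : ∀ r : ℝ, Complex.normSq ((r : ℂ) * (starRingEnd ℂ) t.z * t.u)
        = r ^ 2 * Complex.normSq t.z * Complex.normSq t.u := by
      intro r; rw [map_mul, map_mul, Complex.normSq_ofReal, Complex.normSq_conj]; ring
    have him : |(cutF t.z / t.z : ℂ).im| = cutF t.z / Complex.normSq t.z * |t.z.im| := by
      rw [im_cutF_div, abs_neg, abs_div, abs_mul, abs_of_pos hf, abs_of_pos hN]
      ring
    have him' : |(cutF t.z / (starRingEnd ℂ) t.z : ℂ).im|
        = cutF t.z / Complex.normSq t.z * |t.z.im| := by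
      have := im_cutF_div ((starRingEnd ℂ) t.z)
      rw [cutF_conj] at this
      rw [this, abs_neg, abs_div, abs_mul, abs_of_pos hf, Complex.normSq_conj, abs_of_pos hN,
        Complex.conj_im, abs_neg]
      ring
    have r1 : c.area = cutD t.z ^ 2 * Complex.normSq t.z * t.area →
        κ * t.area ≤ c.area ∧ c.area ≤ (1 - κ) * t.area := by
      intro e
      refine red b1 (by nlinarith) (e.trans ?_)
      rw [sq, mul_assoc (cutD t.z), hdN]; ring
    rcases u_z_of_mem_children ht.1 hg hc with
      ⟨e, e'⟩ | ⟨e, e'⟩ | ⟨e, e'⟩ | ⟨e, e'⟩ | ⟨e, e'⟩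
    · refine r1 ?_
      rw [area, e, e', hns, Complex.conj_im, abs_neg, area]; ring
    · refine red b2 (by nlinarith) ?_
      rw [area, e, e', Complex.normSq_neg, hns', him', area]
      field_simp
    · refine r1 ?_
      rw [area, e, e', hns', area]; ring
    · refine red b3 (by nlinarith) ?_
      rw [area, e, e', ← Complex.ofReal_one, ← Complex.ofReal_sub, hns, him, area]
      field_simp
    · refine red b4 (by nlinarith) ?_
      rw [area, e, e', map_mul, Complex.conj_im, abs_neg, area, cutF_eq]
      ring
  refine ⟨κ, hκ, ?_, key⟩
  have := (h z (by simp [shapes])).trans ((min_le_right _ _).trans (min_le_right _ _))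
  linarith [hz.cutF_pos]

/-- Every point of a tile lies in a descendant of any prescribed area, up to a constant factor. -/
theorem exists_desc_area (hz : GoodShape z) : ∃ κ > 0, ∀ t : CTile, t.InClass z →
    ∀ X ∈ t.carrier, ∀ τ > 0, τ ≤ t.area →
      ∃ n, ∃ s ∈ t.desc n, X ∈ s.carrier ∧ κ * τ ≤ s.area ∧ s.area ≤ τ := by
  obtain ⟨κ, hκ, hκ1, h⟩ := exists_area_child hz
  refine ⟨κ, hκ, fun t ht X hX τ hτ hle => ?_⟩
  obtain ⟨m, hm⟩ : ∃ m : ℕ, (1 - κ) ^ m * t.area ≤ τ := by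
    obtain ⟨m, hm⟩ := exists_pow_lt_of_lt_one (div_pos hτ (ht.area_pos hz))
      (show 1 - κ < 1 by linarith)
    exact ⟨m, by rw [lt_div_iff₀ (ht.area_pos hz)] at hm; exact hm.le⟩
  induction m generalizing t with
  | zero =>
    rw [pow_zero, one_mul] at hm
    exact ⟨0, t, rfl, hX, by nlinarith, hm⟩
  | succ m ih =>
    obtain ⟨c, hc, hXc⟩ := exists_child_mem (ht.good hz) hX
    obtain ⟨h1, h2⟩ := h t ht c hc
    have hdesc : ∀ {n s}, s ∈ c.desc n → s ∈ t.desc (n + 1) := fun {n s} hs => by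
      simp only [CTile.desc, Set.mem_iUnion]
      exact ⟨c, hc, hs⟩
    rcases le_total τ c.area with hcA | hcA
    · obtain ⟨n, s, hs, hr⟩ := ih c (ht.child hz hc) hXc hcA (by
        refine le_trans ?_ hm
        rw [pow_succ, mul_assoc]
        have : 0 ≤ 1 - κ := by linarith
        gcongr)
      exact ⟨n + 1, s, hdesc hs, hr⟩
    · exact ⟨1, c, hdesc (n := 0) rfl, hXc, by nlinarith, hcA⟩

/-! ### Edges in all directions -/

/-- Iterating the passage to the third tile `DFG`, which has the shape of the triangle itself,
turns the side `AB` by the same angle each time. -/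
theorem exists_desc_pow (hz : GoodShape z) (ht : t.InClass z) (k : ℕ) :
    ∃ s ∈ t.desc k, s.u = (cutD t.z * (starRingEnd ℂ) t.z) ^ k * t.u ∧ s.z = t.z := by
  induction k generalizing t with
  | zero => exact ⟨t, rfl, by simp, rfl⟩
  | succ k ih =>
    have hc : (⟨t.D, t.F, t.G⟩ : CTile) ∈ t.children := by simp [children]
    have hu : (⟨t.D, t.F, t.G⟩ : CTile).u = cutD t.z * (starRingEnd ℂ) t.z * t.u := by
      change t.F - t.D = _
      rw [F_eq, D_eq ht.1]
      linear_combination t.u * (ht.good hz).cutF_eq_mul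
    have hzz : (⟨t.D, t.F, t.G⟩ : CTile).z = t.z := by
      have h1 := (ht.good hz).cutF_eq_mul
      have h2 := cutF_eq_conj t.z
      have h0 : (⟨t.D, t.F, t.G⟩ : CTile).u ≠ 0 := (ht.child hz hc).1
      change (t.G - t.D) / CTile.u _ = _
      rw [div_eq_iff h0, hu]
      rw [G_eq ht.1, D_eq ht.1]
      linear_combination (h1 - cutD t.z * h2) * t.u
    obtain ⟨s, hs, e, e'⟩ := ih (ht.child hz hc)
    refine ⟨s, ?_, ?_, e'.trans hzz⟩
    · simp only [CTile.desc, Set.mem_iUnion]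
      exact ⟨_, hc, hs⟩
    · rw [e, hzz, hu]; ring

theorem irrational_arg_of_mem_shapes (hz : GoodShape z) (hirr : Irrational (z.arg / Real.pi))
    {w : ℂ} (hw : w ∈ shapes z) : Irrational (w.arg / Real.pi) := by
  have hpi : z.arg ≠ Real.pi := fun h => hz.1 (Complex.arg_eq_pi_iff.1 h).2
  have hneg : Irrational (-z.arg / Real.pi) := by rw [neg_div]; exact hirr.neg
  rcases hw with rfl | rfl | rfl | rfl
  · exact hirr
  · rw [Complex.arg_conj, if_neg hpi]; exact hneg
  · rw [div_eq_mul_inv (cutF z : ℂ), Complex.arg_real_mul _ hz.cutF_pos, Complex.arg_inv,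
      if_neg hpi]
    exact hneg
  · rw [div_eq_mul_inv (cutF z : ℂ), Complex.arg_real_mul _ hz.cutF_pos, ← map_inv₀,
      Complex.arg_conj, Complex.arg_inv, if_neg hpi]
    rw [if_neg]
    · simpa using hirr
    · intro h
      have := Complex.neg_pi_lt_arg z
      linarith

/-- Every tile has, in a subdivision of bounded depth, an edge in any prescribed direction up to a
prescribed angle `arccos ν`. -/
theorem exists_edge (hz : GoodShape z) (hirr : Irrational (z.arg / Real.pi)) {ν : ℝ} (hν : ν < 1) :
    ∃ δ > 0, ∀ t : CTile, t.InClass z → ∀ ξ : ℂ, ∃ n, ∃ P Q : ℂ, segment ℝ P Q ⊆ t.sk n ∧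
      δ * √t.area ≤ ‖Q - P‖ ∧ ν * (‖Q - P‖ * ‖ξ‖) ≤ ((Q - P) * ξ).re := by
  have hw : ∀ w ∈ shapes z, ∃ δ > 0, ∀ t : CTile, t.InClass z → t.z = w → ∀ ξ : ℂ, ∃ n,
      ∃ P Q : ℂ, segment ℝ P Q ⊆ t.sk n ∧
      δ * √t.area ≤ ‖Q - P‖ ∧ ν * (‖Q - P‖ * ‖ξ‖) ≤ ((Q - P) * ξ).re := by
    intro w hw
    have hg := hz.of_mem_shapes hw
    have hd : 0 < cutD w := hg.cutD_pos
    set ζ : ℂ := cutD w * (starRingEnd ℂ) w with hζ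
    have hζ0 : 0 < ‖ζ‖ := norm_pos_iff.2 (mul_ne_zero (by exact_mod_cast hd.ne') hg.conj.ne_zero)
    obtain ⟨N, hN⟩ := exists_pow_re_ge (ζ := ζ) (by
      rw [hζ, Complex.arg_real_mul _ hd]
      exact irrational_arg_of_mem_shapes hz hirr (conj_mem_shapes hw)) hν
    have him : 0 < |w.im| := abs_pos.2 hg.1
    clear_value ζ
    refine ⟨min ‖ζ‖ 1 ^ N / √|w.im|, by positivity, fun t ht htw ξ => ?_⟩
    obtain ⟨k, hk, hre⟩ := hN (t.u * ξ)
    obtain ⟨s, hs, hsu, -⟩ := exists_desc_pow hz ht k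
    have hsu' : s.B - s.A = ζ ^ k * t.u := by change s.u = _; rw [hsu, htw, ← hζ]
    refine ⟨k, s.A, s.B, ?_, ?_, ?_⟩
    · exact (segments_subset_boundary s.A s.B s.C).1.1.trans
        (Set.subset_biUnion_of_mem (u := fun s : CTile => s.boundary) hs)
    · rw [hsu', area, htw, Complex.normSq_eq_norm_sq, Real.sqrt_mul (by positivity),
        Real.sqrt_sq (norm_nonneg _), norm_mul, norm_pow]
      have h1 : min ‖ζ‖ 1 ^ N ≤ ‖ζ‖ ^ k :=
        (pow_le_pow_of_le_one (by positivity) (min_le_right _ _) hk).trans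
          (pow_le_pow_left₀ (by positivity) (min_le_left _ _) k)
      calc min ‖ζ‖ 1 ^ N / √|w.im| * (‖t.u‖ * √|w.im|) = min ‖ζ‖ 1 ^ N * ‖t.u‖ := by
            field_simp
        _ ≤ _ := by gcongr
    · rw [hsu', ← norm_mul, mul_assoc]
      exact hre
  choose! δ hδ h using hw
  obtain ⟨δ₀, hδ₀, hle⟩ := exists_pos_le_of_finite (finite_shapes z) hδ
  refine ⟨δ₀, hδ₀, fun t ht ξ => ?_⟩
  obtain ⟨n, P, Q, h1, h2, h3⟩ := h t.z ht.2 t ht rfl ξ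
  exact ⟨n, P, Q, h1, le_trans (by gcongr; exact hle _ ht.2) h2, h3⟩

/-! ### Improving the distortion -/

/-- In every tile arising from the shape `z`, any two points of a skeleton are joined in deeper
skeletons by paths at most `R` times longer than their distance, up to an arbitrarily small
error. -/
def Distortion (z : ℂ) (R : ℝ) : Prop :=
  ∀ t : CTile, t.InClass z → ∀ n, ∀ X ∈ t.sk n, ∀ Y ∈ t.sk n, ∀ ε > 0, ∃ m,
    Reach (t.sk m) X Y (R * dist X Y + ε)

/-- Some distortion bound holds: walking around every tile met by the chord costs a constant
factor. -/
theorem exists_distortion (hz : GoodShape z) : ∃ K, 1 ≤ K ∧ Distortion z K := by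
  obtain ⟨M, hM⟩ := ((finite_shapes z).image fun w => 2 * ((1 + ‖w‖) / |w.im|)).bddAbove
  refine ⟨max 1 M, le_max_left _ _, fun t ht n X hX Y hY ε hε => ⟨n, ?_⟩⟩
  refine (quasiConvex_sk hz (K := max 1 M) (fun t ht => ?_) n ht X hX Y hY).mono subset_rfl
    (by linarith)
  exact quasiConvex_boundary (ht.good hz) ht.1
    ((hM (Set.mem_image_of_mem _ ht.2)).trans (le_max_right _ _))

theorem norm_add_le_of_re {v w : ℂ} (hv : v ≠ 0) :
    ‖v + w‖ ≤ ‖v‖ + (w * (starRingEnd ℂ) v).re / ‖v‖ + ‖w‖ ^ 2 / (2 * ‖v‖) := by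
  have hv' : 0 < ‖v‖ := norm_pos_iff.2 hv
  have h : ‖v + w‖ ^ 2 = ‖v‖ ^ 2 + 2 * (w * (starRingEnd ℂ) v).re + ‖w‖ ^ 2 := by
    simp only [← Complex.normSq_eq_norm_sq, Complex.normSq_apply, Complex.add_re, Complex.add_im,
      Complex.mul_re, Complex.conj_re, Complex.conj_im]
    ring
  have e : ‖v‖ + (w * (starRingEnd ℂ) v).re / ‖v‖ + ‖w‖ ^ 2 / (2 * ‖v‖)
      = (‖v‖ ^ 2 + ‖v + w‖ ^ 2) / (2 * ‖v‖) := by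
    rw [h]; field_simp; ring
  rw [e, le_div_iff₀ (by positivity)]
  nlinarith [sq_nonneg (‖v‖ - ‖v + w‖)]

/-- A detour through a short segment `PQ` close to the midpoint of `XY` and nearly parallel to it
costs only a second-order term. -/
theorem detour_le {X Y P Q : ℂ} (hXY : X ≠ Y) {r ν : ℝ}
    (hP : dist P (midpoint ℝ X Y) ≤ r) (hQ : dist Q (midpoint ℝ X Y) ≤ r)
    (hν : ν * (‖Q - P‖ * ‖Y - X‖) ≤ ((Q - P) * (starRingEnd ℂ) (Y - X)).re) :
    dist X P + dist Q Y ≤ dist X Y - ν * ‖Q - P‖ + 2 * r ^ 2 / dist X Y := by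
  set v : ℂ := (Y - X) / 2 with hv
  have hv0 : v ≠ 0 := div_ne_zero (sub_ne_zero.2 hXY.symm) two_ne_zero
  have hn : ‖Y - X‖ = 2 * ‖v‖ := by rw [hv, norm_div]; simp; ring
  have hvp : 0 < ‖v‖ := norm_pos_iff.2 hv0
  have hM : midpoint ℝ X Y = (X + Y) / 2 := by
    rw [midpoint_eq_smul_add, Complex.real_smul]; simp; ring
  rw [hM, dist_eq_norm] at hP hQ
  have h1 := norm_add_le_of_re (w := P - (X + Y) / 2) hv0
  have h2 := norm_add_le_of_re (w := -(Q - (X + Y) / 2)) hv0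
  rw [norm_neg] at h2
  have e1 : dist X P = ‖v + (P - (X + Y) / 2)‖ := by
    rw [dist_comm, dist_eq_norm]; congr 1; rw [hv]; ring
  have e2 : dist Q Y = ‖v + -(Q - (X + Y) / 2)‖ := by
    rw [dist_comm, dist_eq_norm]; congr 1; rw [hv]; ring
  have e3 : dist X Y = 2 * ‖v‖ := by rw [dist_comm, dist_eq_norm, hn]
  have hre : ((P - (X + Y) / 2) * (starRingEnd ℂ) v).re / ‖v‖ +
      (-(Q - (X + Y) / 2) * (starRingEnd ℂ) v).re / ‖v‖ ≤ -(ν * ‖Q - P‖) := by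
    rw [← add_div, div_le_iff₀ hvp, ← Complex.add_re, ← add_mul]
    have hvv : (starRingEnd ℂ) (Y - X) = ((2 : ℝ) : ℂ) * (starRingEnd ℂ) v := by
      rw [← Complex.conj_ofReal 2, ← map_mul]
      congr 1
      rw [hv]; push_cast; ring
    have hmul : ((Q - P) * (((2 : ℝ) : ℂ) * (starRingEnd ℂ) v)).re
        = 2 * ((Q - P) * (starRingEnd ℂ) v).re := by
      rw [← Complex.re_ofReal_mul]; congr 1; ring
    rw [hvv, hn, hmul] at hν
    have : P - (X + Y) / 2 + -(Q - (X + Y) / 2) = -(Q - P) := by ring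
    rw [this, neg_mul, Complex.neg_re]
    linarith
  have hr : ‖P - (X + Y) / 2‖ ^ 2 / (2 * ‖v‖) + ‖Q - (X + Y) / 2‖ ^ 2 / (2 * ‖v‖)
      ≤ 2 * r ^ 2 / (2 * ‖v‖) := by
    rw [← add_div]
    gcongr
    have := pow_le_pow_left₀ (norm_nonneg _) hP 2
    have := pow_le_pow_left₀ (norm_nonneg _) hQ 2
    linarith
  rw [e1, e2, e3]
  linarith

/-- A distortion bound `R > 1` is never optimal: near the midpoint of any chord there is an edge of
comparable length almost parallel to it, and the path can be led along that edge. -/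
theorem Distortion.improve (hz : GoodShape z) (hirr : Irrational (z.arg / Real.pi)) {R : ℝ}
    (hR : 1 < R) (h : Distortion z R) : ∃ η > 0, Distortion z (R - η) := by
  obtain ⟨H, hH, hdiam⟩ := exists_dist_le_sqrt_area hz
  obtain ⟨κ, hκ, harea⟩ := exists_desc_area hz
  -- `R ν > 1`, so that exchanging a piece of the chord for an edge at angle `arccos ν` pays off
  set ν : ℝ := 2 / (R + 1) with hν
  have hν1 : ν < 1 := by rw [hν, div_lt_one (by linarith)]; linarith
  obtain ⟨δ, hδ, hedge⟩ := exists_edge hz hirr hν1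
  set g : ℝ := R * ν - 1 with hg
  have hgpos : 0 < g := by
    rw [hg, hν, ← mul_div_assoc, sub_pos, one_lt_div (by linarith)]; linarith
  -- tiles of size at most `lam` times the chord make the second-order cost negligible
  set lam : ℝ := min (1 / H) (g * δ / (4 * R * H ^ 2)) with hlam
  have hlam0 : 0 < lam := lt_min (by positivity) (by positivity)
  have hlam1 : lam * H ≤ 1 := by
    have := min_le_left (1 / H) (g * δ / (4 * R * H ^ 2))
    rwa [← hlam, le_div_iff₀ hH] at this
  have hlam2 : 4 * R * H ^ 2 * lam ≤ g * δ := by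
    have := min_le_right (1 / H) (g * δ / (4 * R * H ^ 2))
    rw [← hlam, le_div_iff₀ (by positivity)] at this
    linarith
  refine ⟨g * δ * (√κ * lam) / 2, by positivity, fun t ht n X hX Y hY ε hε => ?_⟩
  rcases eq_or_ne X Y with rfl | hXY
  · exact ⟨n, Reach.nil hX (by simpa using hε.le)⟩
  set l : ℝ := dist X Y with hl
  have hl0 : 0 < l := dist_pos.2 hXY
  have hXc := sk_subset_carrier hz ht n hX
  have hYc := sk_subset_carrier hz ht n hY
  have hMc : midpoint ℝ X Y ∈ t.carrier :=
    (convex_convexHull ℝ _).midpoint_mem hXc hYc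
  have hle : (lam * l) ^ 2 ≤ t.area := by
    rw [← Real.sq_sqrt (ht.area_pos hz).le]
    refine pow_le_pow_left₀ (by positivity) ?_ 2
    have := hdiam t ht X hXc Y hYc
    calc lam * l ≤ lam * (H * √t.area) := by gcongr
      _ = lam * H * √t.area := by ring
      _ ≤ 1 * √t.area := by gcongr
      _ = _ := one_mul _
  obtain ⟨k, s, hs, hMs, hs1, hs2⟩ := harea t ht _ hMc _ (by positivity) hle
  have hsz := ht.desc hz hs
  set σ : ℝ := √s.area with hσ
  have hσ1 : √κ * (lam * l) ≤ σ := by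
    rw [hσ, ← Real.sqrt_sq (show 0 ≤ lam * l by positivity), ← Real.sqrt_mul hκ.le]
    exact Real.sqrt_le_sqrt hs1
  have hσ2 : σ ≤ lam * l := by
    rw [hσ, ← Real.sqrt_sq (show 0 ≤ lam * l by positivity)]
    exact Real.sqrt_le_sqrt hs2
  obtain ⟨j, P, Q, hPQ, hlen, hdir⟩ := hedge s hsz ((starRingEnd ℂ) (Y - X))
  rw [Complex.norm_conj] at hdir
  have hPs := hPQ (left_mem_segment ℝ P Q)
  have hQs := hPQ (right_mem_segment ℝ P Q)
  have hPd := hdiam s hsz P (sk_subset_carrier hz hsz j hPs) _ hMs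
  have hQd := hdiam s hsz Q (sk_subset_carrier hz hsz j hQs) _ hMs
  have hdet := detour_le hXY hPd hQd hdir
  have hst := sk_desc_subset hs j
  have up : ∀ {m m' : ℕ}, m ≤ m' → t.sk m ⊆ t.sk m' := fun h => sk_mono hz ht h
  obtain ⟨m₁, r₁⟩ := h t ht (max n (k + j)) X (up (le_max_left _ _) hX) P
    (up (le_max_right _ _) (hst hPs)) (ε / 2) (by positivity)
  obtain ⟨m₂, r₂⟩ := h t ht (max n (k + j)) Q (up (le_max_right _ _) (hst hQs)) Y
    (up (le_max_left _ _) hY) (ε / 2) (by positivity)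
  have r₃ : Reach (t.sk (k + j)) P Q ‖Q - P‖ :=
    Reach.of_segment (hPQ.trans hst) (by rw [dist_comm, dist_eq_norm])
  refine ⟨max (max m₁ m₂) (k + j), (((r₁.mono (up (by omega)) le_rfl).trans
    (r₃.mono (up (by omega)) le_rfl)).trans (r₂.mono (up (by omega)) le_rfl)).mono subset_rfl ?_⟩
  rw [← hl] at hdet
  have hcost : 2 * (H * σ) ^ 2 / l ≤ 2 * H ^ 2 * lam * σ := by
    rw [div_le_iff₀ hl0]
    have : 0 ≤ σ := Real.sqrt_nonneg _
    have := mul_le_mul_of_nonneg_left hσ2 (show 0 ≤ 2 * H ^ 2 * σ by positivity)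
    linarith
  have hσ0 : 0 ≤ σ := Real.sqrt_nonneg _
  have e1 := mul_le_mul_of_nonneg_left hdet (show 0 ≤ R by linarith)
  have e2 := mul_le_mul_of_nonneg_left hcost (show 0 ≤ R by linarith)
  have e3 := mul_le_mul_of_nonneg_right hlam2 hσ0
  have e4 := mul_le_mul_of_nonneg_left hlen hgpos.le
  have e5 := mul_le_mul_of_nonneg_left hσ1 (show 0 ≤ g * δ / 2 by positivity)
  rw [← hσ] at e4
  have e6 : R * (ν * ‖Q - P‖) = (g + 1) * ‖Q - P‖ := by rw [hg]; ring
  linarith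

/-- The limit distance along the skeletons is the Euclidean distance. -/
theorem distortion_one (hz : GoodShape z) (hirr : Irrational (z.arg / Real.pi)) :
    Distortion z 1 := by
  set 𝓡 : Set ℝ := {R | 1 ≤ R ∧ Distortion z R} with h𝓡
  have hne : 𝓡.Nonempty := exists_distortion hz
  have hbdd : BddBelow 𝓡 := ⟨1, fun R hR => hR.1⟩
  have h1 : 1 ≤ sInf 𝓡 := le_csInf hne fun R hR => hR.1
  have hmem : Distortion z (sInf 𝓡) := by
    intro t ht n X hX Y hY ε hε
    obtain ⟨R, hR, hlt⟩ := exists_lt_of_csInf_lt hne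
      (show sInf 𝓡 < sInf 𝓡 + ε / 2 / (dist X Y + 1) by
        have : 0 < dist X Y + 1 := by positivity
        have : 0 < ε / 2 / (dist X Y + 1) := by positivity
        linarith)
    obtain ⟨m, hm⟩ := hR.2 t ht n X hX Y hY (ε / 2) (by positivity)
    refine ⟨m, hm.mono subset_rfl ?_⟩
    have hd := dist_nonneg (x := X) (y := Y)
    have := mul_le_mul_of_nonneg_right hlt.le hd
    have h2 : ε / 2 / (dist X Y + 1) * dist X Y ≤ ε / 2 := by
      rw [div_mul_eq_mul_div, div_le_iff₀ (by positivity)]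
      nlinarith
    linarith
  rcases h1.eq_or_lt with h | h
  · rwa [← h] at hmem
  · obtain ⟨η, hη, hD⟩ := hmem.improve hz hirr h
    -- a smaller improvement that keeps the bound above `1`
    exfalso
    have hD' : max (sInf 𝓡 - η) 1 ∈ 𝓡 := by
      refine ⟨le_max_right _ _, fun t ht n X hX Y hY ε hε => ?_⟩
      obtain ⟨m, hm⟩ := hD t ht n X hX Y hY ε hε
      refine ⟨m, hm.mono subset_rfl ?_⟩
      gcongr
      exact le_max_left _ _
    have := csInf_le hbdd hD'
    rcases le_max_iff.1 this with h' | h' <;> linarith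

end CTile

/-! ### Transfer to the Euclidean plane -/

/-- The identification of the complex plane with the Euclidean plane. -/
noncomputable def toPlane : ℂ ≃ₗᵢ[ℝ] Plane := Complex.orthonormalBasisOneI.repr

namespace CTile

/-- The labelled triangle in the Euclidean plane. -/
noncomputable def toTile (t : CTile) : Tile := ⟨toPlane t.A, toPlane t.B, toPlane t.C⟩

/-- The point of the Euclidean plane with coordinate `x` in the frame of `t`, where `A` has
coordinate `0` and `B` has coordinate `1`. -/
noncomputable def pt (t : CTile) (x : ℂ) : Plane := toPlane (t.A + x * t.u)

end CTile

theorem image_segment_toPlane (P Q : ℂ) :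
    toPlane '' segment ℝ P Q = segment ℝ (toPlane P) (toPlane Q) :=
  image_segment ℝ toPlane.toLinearEquiv.toLinearMap.toAffineMap P Q

theorem CTile.boundary_toTile (t : CTile) : t.toTile.boundary = toPlane '' t.boundary := by
  rw [CTile.boundary, Set.image_union, Set.image_union, image_segment_toPlane,
    image_segment_toPlane, image_segment_toPlane]
  rfl

theorem CTile.carrier_toTile (t : CTile) : t.toTile.carrier = toPlane '' t.carrier := by
  have := toPlane.toLinearEquiv.toLinearMap.image_convexHull {t.A, t.B, t.C}
  refine Eq.trans ?_ this.symm
  simp [Tile.carrier, CTile.toTile, Set.image_insert_eq]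

theorem exists_toTile (T : Tile) : ∃ t : CTile, t.toTile = T :=
  ⟨⟨toPlane.symm T.A, toPlane.symm T.B, toPlane.symm T.C⟩, by simp [CTile.toTile]⟩

open scoped EuclideanGeometry in
theorem CTile.angle_pt {t : CTile} (hu : t.u ≠ 0) {x y w : ℂ} (hx : x ≠ y) (hw : w ≠ y) :
    ∠ (t.pt x) (t.pt y) (t.pt w) = |((x - y) / (w - y)).arg| := by
  have e : ∀ v : ℂ, t.pt v -ᵥ t.pt y = toPlane ((v - y) * t.u) := by
    intro v
    rw [vsub_eq_sub, pt, pt, ← map_sub]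
    congr 1
    ring
  rw [EuclideanGeometry.angle, e, e, ← LinearIsometryEquiv.coe_toLinearIsometry,
    LinearIsometry.angle_map, Complex.angle_mul_right hu,
    Complex.angle_eq_abs_arg (sub_ne_zero.2 hx) (sub_ne_zero.2 hw)]

theorem exists_pos_mul_of_abs_arg_eq {x y : ℂ} (h : |x.arg| = |y.arg|) (him : 0 < x.im * y.im) :
    ∃ r : ℝ, x = r * y := by
  have hx : x ≠ 0 := by rintro rfl; simp at him
  have hy : y ≠ 0 := by rintro rfl; simp at him
  have harg : y.arg = x.arg := by
    rcases pos_and_pos_or_neg_and_neg_of_mul_pos him with ⟨h1, h2⟩ | ⟨h1, h2⟩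
    · rwa [abs_of_nonneg (Complex.arg_nonneg_iff.2 h1.le),
        abs_of_nonneg (Complex.arg_nonneg_iff.2 h2.le), eq_comm] at h
    · rw [abs_of_neg (Complex.arg_neg_iff.2 h1), abs_of_neg (Complex.arg_neg_iff.2 h2)] at h
      linarith
  refine ⟨‖x‖ / ‖y‖, ?_⟩
  push_cast
  exact ((Complex.arg_eq_arg_iff hy hx).1 harg).symm

theorem im_div_mul_pos {a b c d : ℂ} (hb : b ≠ 0) (hd : d ≠ 0)
    (h : 0 < (a * (starRingEnd ℂ) b).im * (c * (starRingEnd ℂ) d).im) :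
    0 < (a / b).im * (c / d).im := by
  have e : ∀ p q : ℂ, (p / q).im = (p * (starRingEnd ℂ) q).im * (Complex.normSq q)⁻¹ := by
    intro p q
    rw [div_eq_mul_inv, Complex.inv_def, ← mul_assoc, mul_comm _ ((_ : ℝ) : ℂ),
      Complex.im_ofReal_mul, mul_comm]
  rw [e, e]
  have := inv_pos.2 (Complex.normSq_pos.2 hb)
  have := inv_pos.2 (Complex.normSq_pos.2 hd)
  calc (0 : ℝ) < _ := mul_pos h (mul_pos ‹0 < (Complex.normSq b)⁻¹› this)
    _ = _ := by ring

/-- If two quotients with imaginary parts of the same sign have equal unoriented arguments, they are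
real multiples of each other. -/
theorem exists_real_of_abs_arg_div_eq {a b c d : ℂ} (hb : b ≠ 0) (hd : d ≠ 0)
    (h : |(a / b).arg| = |(c / d).arg|)
    (him : 0 < (a * (starRingEnd ℂ) b).im * (c * (starRingEnd ℂ) d).im) :
    ∃ r : ℝ, a * d = r * (c * b) := by
  obtain ⟨r, hr⟩ := exists_pos_mul_of_abs_arg_eq h (im_div_mul_pos hb hd him)
  refine ⟨r, ?_⟩
  rw [div_eq_iff hb] at hr
  rw [hr]
  field_simp

namespace CTile

variable {t : CTile} {z : ℂ}

theorem pt_zero (t : CTile) : t.pt 0 = t.toTile.A := by simp [pt, toTile]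

theorem pt_one (t : CTile) : t.pt 1 = t.toTile.B := by simp [pt, toTile, u]

theorem pt_z (hu : t.u ≠ 0) : t.pt t.z = t.toTile.C := by
  simp only [pt, toTile]
  rw [← C_eq hu]

theorem exists_pt_of_sbtw {x y : ℂ} {P : Plane} (h : Sbtw ℝ (t.pt x) P (t.pt y)) :
    ∃ r : ℝ, 0 < r ∧ r < 1 ∧ P = t.pt (x + r * (y - x)) := by
  obtain ⟨⟨r, ⟨h0, h1⟩, rfl⟩, -⟩ := sbtw_iff_mem_image_Ioo_and_ne.1 h
  refine ⟨r, h0, h1, ?_⟩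
  rw [AffineMap.lineMap_apply, vsub_eq_sub, vadd_eq_add, pt, pt, pt, ← map_sub, ← map_smul,
    ← map_add, Complex.real_smul]
  congr 1
  ring

/-- The defining angle conditions determine the points of the subdivision. In the frame of the
triangle each point has one unknown real coordinate; an angle condition says that two complex
numbers, whose imaginary parts have the same sign by betweenness, are real multiples of each other,
which is a linear system for the coordinate and the multiplier. -/
theorem eq_of_isSplitPoints (hu : t.u ≠ 0) (h : GoodShape t.z) {D E F G : Plane}
    (hs : IsSplitPoints t.toTile D E F G) :
    D = toPlane t.D ∧ E = toPlane t.E ∧ F = toPlane t.F ∧ G = toPlane t.G := by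
  obtain ⟨hF, hFa, hD, hDa, hE, hEa, hG, hGa⟩ := hs
  rw [Tile.a] at hFa hGa
  rw [Tile.b] at hDa hEa
  rw [← pt_zero, ← pt_one] at hF hFa hDa hE hEa hGa
  rw [← pt_zero] at hD
  rw [← pt_z hu] at hFa hD hDa hG hGa hEa
  have him := h.1
  have him2 : 0 < t.z.im * t.z.im := mul_self_pos.2 him
  have hre := h.re_pos
  have hz0 := h.ne_zero
  have h1z := h.one_sub_ne_zero
  have hz1 : t.z ≠ 1 := fun e => h1z (by rw [e]; ring)
  have hreal : ∀ {r : ℝ}, (r : ℂ) ≠ t.z := fun {r} e => him (by rw [← e]; simp)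
  -- the point `F`
  obtain ⟨f, hf0, hf1, rfl⟩ := exists_pt_of_sbtw hF
  rw [sub_zero, zero_add, mul_one] at *
  rw [angle_pt hu hreal hz1.symm, angle_pt hu one_ne_zero hz0, sub_zero, sub_zero] at hFa
  have hf : f = cutF t.z := by
    obtain ⟨r, hr⟩ := exists_real_of_abs_arg_div_eq h1z hz0 hFa (by
      have : (((f : ℂ) - t.z) * (starRingEnd ℂ) (1 - t.z)).im * (1 * (starRingEnd ℂ) t.z).im
          = (1 - f) * (t.z.im * t.z.im) := by
        simp; ring
      rw [this]
      exact mul_pos (by linarith) him2)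
    have e1 := congrArg Complex.re hr
    have e2 := congrArg Complex.im hr
    simp at e1 e2
    have e3 : f = 2 * t.z.re - r := mul_right_cancel₀ him (by linear_combination e2)
    rw [cutF, Complex.normSq_apply]
    subst e3
    linear_combination e1
  -- the point `D`
  obtain ⟨d, hd0, hd1, rfl⟩ := exists_pt_of_sbtw hD
  rw [sub_zero, zero_add] at *
  have hdf : (d : ℂ) * t.z ≠ f := fun e => by
    have := congrArg Complex.im e
    simp [hd0.ne', him] at this
  rw [angle_pt hu hdf hreal.symm, angle_pt hu zero_ne_one hz1] at hDa
  have hd : d = cutD t.z := by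
    obtain ⟨r, hr⟩ := exists_real_of_abs_arg_div_eq (sub_ne_zero.2 hreal.symm)
      (sub_ne_zero.2 hz1) hDa (by
      have : ((d * t.z - f : ℂ) * (starRingEnd ℂ) (t.z - f)).im
          * ((0 - 1) * (starRingEnd ℂ) (t.z - 1)).im
          = f * (1 - d) * (t.z.im * t.z.im) := by
        simp; ring
      rw [this]
      exact mul_pos (mul_pos hf0 (by linarith)) him2)
    have e1 := congrArg Complex.re hr
    have e2 := congrArg Complex.im hr
    simp at e1 e2
    have e3 : r = d - 2 * d * t.z.re + f := mul_right_cancel₀ him (by linear_combination e2)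
    rw [cutD, ← hf, eq_div_iff (by positivity)]
    subst e3
    have hf' : f = 2 * t.z.re - (t.z.re * t.z.re + t.z.im * t.z.im) := by
      rw [hf, cutF, Complex.normSq_apply]
    refine mul_right_cancel₀ (sub_pos.2 hf1).ne' ?_
    linear_combination -e1 - d * hf'
  -- the point `E`
  obtain ⟨e, he0, he1, rfl⟩ := exists_pt_of_sbtw hE
  rw [sub_zero, zero_add, mul_one] at *
  have hde : (e : ℂ) ≠ d * t.z := fun e => by
    have := congrArg Complex.im e
    simp [hd0.ne', him] at this
  have hd0' : (0 : ℂ) ≠ d * t.z := (mul_ne_zero (by exact_mod_cast hd0.ne') hz0).symm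
  rw [EuclideanGeometry.angle_comm, angle_pt hu hde hd0', angle_pt hu zero_ne_one hz1] at hEa
  have he : e = (1 - d) * f := by
    obtain ⟨r, hr⟩ := exists_real_of_abs_arg_div_eq (sub_ne_zero.2 hd0')
      (sub_ne_zero.2 hz1) hEa (by
      have : ((e - d * t.z : ℂ) * (starRingEnd ℂ) (0 - d * t.z)).im
          * ((0 - 1) * (starRingEnd ℂ) (t.z - 1)).im
          = e * d * (t.z.im * t.z.im) := by
        simp; ring
      rw [this]
      exact mul_pos (mul_pos he0 hd0) him2)
    have e1 := congrArg Complex.re hr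
    have e2 := congrArg Complex.im hr
    simp at e1 e2
    have e3 : r * d = d - 2 * d * t.z.re + e := mul_right_cancel₀ him (by linear_combination -e2)
    have hf' : f = 2 * t.z.re - (t.z.re * t.z.re + t.z.im * t.z.im) := by
      rw [hf, cutF, Complex.normSq_apply]
    have hd' : d * (2 * t.z.re) = f := by
      rw [hd, cutD, ← hf, div_mul_cancel₀ _ (by positivity)]
    linear_combination -e1 - t.z.re * e3 + d * hf' + hd'
  -- the point `G`
  obtain ⟨g, hg0, hg1, rfl⟩ := exists_pt_of_sbtw hG
  have hdz : t.z - d * t.z ≠ 0 := by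
    have : t.z - d * t.z = ((1 - d : ℝ) : ℂ) * t.z := by push_cast; ring
    rw [this]
    exact mul_ne_zero (by exact_mod_cast (sub_pos.2 hd1).ne') hz0
  have hgim : ((t.z + g * (f - t.z) - d * t.z : ℂ) * (starRingEnd ℂ) (t.z - d * t.z)).im
          * (1 * (starRingEnd ℂ) t.z).im
          = g * f * (1 - d) * (t.z.im * t.z.im) := by
    simp; ring
  have hgpos : 0 < g * f * (1 - d) * (t.z.im * t.z.im) :=
    mul_pos (mul_pos (mul_pos hg0 hf0) (by linarith)) him2
  have hgd : (t.z + g * (f - t.z) : ℂ) ≠ d * t.z := fun e => by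
    rw [e, sub_self, zero_mul, Complex.zero_im, zero_mul] at hgim
    exact hgpos.ne hgim
  rw [angle_pt hu hgd (sub_ne_zero.1 hdz), angle_pt hu one_ne_zero hz0, sub_zero, sub_zero] at hGa
  have hg : g = 1 - d := by
    obtain ⟨r, hr⟩ := exists_real_of_abs_arg_div_eq hdz hz0 hGa (hgim ▸ hgpos)
    have hr' : t.z + g * (f - t.z) - d * t.z = r * (1 - d) :=
      mul_right_cancel₀ hz0 (by linear_combination hr)
    have e2 := congrArg Complex.im hr'
    simp at e2
    exact mul_right_cancel₀ him (by linear_combination -e2)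
  rw [D_eq hu, E_eq, F_eq, G_eq hu, ← hf, ← hd, hg, he]
  refine ⟨rfl, ?_, rfl, ?_⟩
  · rw [pt]; push_cast; rfl
  · rw [pt]; congr 2; push_cast; ring

theorem children_toTile (t : CTile) :
    Pinwheel.children t.toTile (toPlane t.D) (toPlane t.E) (toPlane t.F) (toPlane t.G)
      = toTile '' t.children := by
  simp [children, Pinwheel.children, Set.image_insert_eq, toTile]

/-- A tile of the uniform subdivision of a triangle either has its boundary in the skeleton of a
given tiling or lies inside a tile of that tiling. -/
theorem desc_of_isTiling (hz : GoodShape z) (ht : t.InClass z) {𝒯 : Set Tile}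
    (h : IsTiling t.toTile 𝒯) : (∀ τ ∈ 𝒯, ∃ r : CTile, r.InClass z ∧ r.toTile = τ) ∧
    ∀ n, ∀ s ∈ t.desc n, s.toTile.boundary ⊆ skeleton 𝒯 ∨
      ∃ r : CTile, r.InClass z ∧ r.toTile ∈ 𝒯 ∧ ∃ m, s ∈ r.desc m := by
  induction h with
  | root =>
    exact ⟨fun τ hτ => ⟨t, ht, (Set.mem_singleton_iff.1 hτ).symm⟩,
      fun n s hs => Or.inr ⟨t, ht, rfl, n, hs⟩⟩
  | @split 𝒯 τ D E F G hT hτ hsp ih =>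
    obtain ⟨ih1, ih2⟩ := ih
    -- the children do not depend on the complex tile representing `τ`
    have hch : ∀ r : CTile, r.InClass z → r.toTile = τ →
        Pinwheel.children τ D E F G = toTile '' r.children := by
      rintro r hr rfl
      obtain ⟨rfl, rfl, rfl, rfl⟩ := eq_of_isSplitPoints hr.1 (hr.good hz) hsp
      exact r.children_toTile
    obtain ⟨q, hq, hqτ⟩ := ih1 τ hτ
    have hbd : τ.boundary ⊆ skeleton ((𝒯 \ {τ}) ∪ Pinwheel.children τ D E F G) := by
      rw [hch q hq hqτ, ← hqτ, boundary_toTile]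
      rintro _ ⟨X, hX, rfl⟩
      obtain ⟨c, hc, hXc⟩ := Set.mem_iUnion₂.1 (boundary_subset_children (hq.good hz) hX)
      refine Set.mem_iUnion₂.2 ⟨c.toTile, Or.inr ⟨c, hc, rfl⟩, ?_⟩
      rw [boundary_toTile]
      exact ⟨X, hXc, rfl⟩
    have hsk : skeleton 𝒯 ⊆ skeleton ((𝒯 \ {τ}) ∪ Pinwheel.children τ D E F G) := by
      refine Set.iUnion₂_subset fun σ hσ => ?_
      rcases eq_or_ne σ τ with rfl | hne
      · exact hbd
      · exact Set.subset_biUnion_of_mem (u := fun σ : Tile => σ.boundary) (Or.inl ⟨hσ, hne⟩)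
    refine ⟨?_, fun n s hs => ?_⟩
    · rintro σ (hσ | hσ)
      · exact ih1 σ hσ.1
      · rw [hch q hq hqτ] at hσ
        obtain ⟨c, hc, rfl⟩ := hσ
        exact ⟨c, hq.child hz hc, rfl⟩
    · rcases ih2 n s hs with h | ⟨r, hr, hrT, m, hm⟩
      · exact Or.inl (h.trans hsk)
      · rcases eq_or_ne r.toTile τ with hrτ | hne
        · cases m with
          | zero =>
            rw [desc, Set.mem_singleton_iff] at hm
            rw [hm, hrτ]
            exact Or.inl hbd
          | succ m =>
            simp only [desc, Set.mem_iUnion] at hm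
            obtain ⟨c, hc, hm⟩ := hm
            refine Or.inr ⟨c, hr.child hz hc, Or.inr ?_, m, hm⟩
            rw [hch r hr hrτ]
            exact ⟨c, hc, rfl⟩
        · exact Or.inr ⟨r, hr, Or.inl ⟨hrT, hne⟩, m, hm⟩

theorem finite_desc (t : CTile) (n : ℕ) : (t.desc n).Finite := by
  induction n generalizing t with
  | zero => exact Set.finite_singleton t
  | succ n ih =>
    have : t.children.Finite := by unfold children; exact Set.toFinite _
    exact this.biUnion fun c _ => ih c

/-- Tilings with mesh tending to zero eventually contain the skeleton of every uniform
subdivision. -/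
theorem eventually_sk_subset (hz : GoodShape z) (ht : t.InClass z) {𝒯 : ℕ → Set Tile}
    (htil : ∀ i, IsTiling t.toTile (𝒯 i))
    (hdiam : Tendsto (fun i => maxDiam (𝒯 i)) atTop (𝓝 0)) (n : ℕ) :
    ∀ᶠ i in atTop, toPlane '' t.sk n ⊆ skeleton (𝒯 i) := by
  have hev : ∀ s ∈ t.desc n, ∀ᶠ i in atTop, s.toTile.boundary ⊆ skeleton (𝒯 i) := by
    intro s hs
    have hsz := ht.desc hz hs
    have hpos : 0 < dist s.A s.B := dist_pos.2 fun e => hsz.1 (by rw [u, e, sub_self])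
    filter_upwards [hdiam.eventually_lt_const hpos] with i hi
    refine ((desc_of_isTiling hz ht (htil i)).2 n s hs).resolve_right ?_
    rintro ⟨r, hr, hrT, m, hm⟩
    have hsub := carrier_desc_subset hz hr hm
    have hb : Bornology.IsBounded r.toTile.carrier :=
      isBounded_convexHull.2 (Set.toFinite _).isBounded
    have hd : dist s.A s.B ≤ Metric.diam r.toTile.carrier := by
      rw [← toPlane.dist_map]
      refine Metric.dist_le_diam_of_mem hb ?_ ?_ <;> rw [carrier_toTile]
      · exact ⟨_, hsub s.mem_carrier.1, rfl⟩
      · exact ⟨_, hsub s.mem_carrier.2.1, rfl⟩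
    have hle : Metric.diam r.toTile.carrier ≤ maxDiam (𝒯 i) :=
      le_csSup ((htil i).finite.image _).bddAbove ⟨_, hrT, rfl⟩
    linarith
  filter_upwards [(eventually_all_finite (t.finite_desc n)).2 hev] with i hi
  rw [sk, Set.image_iUnion₂]
  exact Set.iUnion₂_subset fun s hs => by
    rw [← boundary_toTile]
    exact hi s hs

/-- Nondegeneracy means `Im z ≠ 0`, and `a < c` means `BC < AB`, that is `|1 - z| < 1`. -/
theorem goodShape_of_toTile {T : Tile} (hT : T.Nondegenerate) (hac : T.a < T.c)
    (h : t.toTile = T) : t.u ≠ 0 ∧ GoodShape t.z := by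
  subst h
  rw [Tile.Nondegenerate, affineIndependent_iff_not_collinear_set] at hT
  have hu : t.u ≠ 0 := by
    intro h0
    apply hT
    have : t.toTile.B = t.toTile.A := by rw [← pt_one, ← pt_zero, pt, pt, h0]; simp
    rw [this]
    simp [collinear_pair]
  have him : t.z.im ≠ 0 := by
    intro h0
    apply hT
    rw [collinear_iff_of_mem (p₀ := t.toTile.A) (by simp)]
    refine ⟨toPlane t.u, ?_⟩
    have hr : ∀ r : ℝ, t.pt r = r • toPlane t.u +ᵥ t.toTile.A := by
      intro r
      rw [← pt_zero, vadd_eq_add, pt, pt, ← map_smul, ← map_add, Complex.real_smul]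
      congr 1
      ring
    have hzr : t.z = (t.z.re : ℂ) := Complex.ext rfl (by simp [h0])
    intro p hp
    rcases hp with rfl | rfl | rfl
    · exact ⟨0, by simp⟩
    · exact ⟨1, by rw [← hr, ← pt_one]; simp⟩
    · exact ⟨t.z.re, by rw [← hr, ← pt_z hu, ← hzr]⟩
  refine ⟨hu, him, ?_⟩
  have hT' : ¬Collinear ℝ {t.toTile.B, t.toTile.C, t.toTile.A} := by
    convert hT using 2
    ext x
    simp only [Set.mem_insert_iff, Set.mem_singleton_iff]
    tauto
  have hlt : dist t.B t.C < dist t.B t.A := by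
    rw [← toPlane.dist_map, ← toPlane.dist_map t.B t.A]
    refine EuclideanGeometry.dist_lt_of_angle_lt hT' ?_
    rw [EuclideanGeometry.angle_comm (toPlane t.B) (toPlane t.C)]
    exact hac
  have hBC : t.B - t.C = (1 - t.z) * t.u := by rw [B_eq, C_eq hu]; ring
  rw [dist_eq_norm, dist_eq_norm, hBC, norm_mul] at hlt
  have h1 : ‖1 - t.z‖ < 1 := by
    have : 0 < ‖t.u‖ := norm_pos_iff.2 hu
    change _ < ‖t.u‖ at hlt
    nlinarith
  have h2 : 0 < cutF t.z := by
    rw [cutF_eq, Complex.normSq_eq_norm_sq]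
    nlinarith [norm_nonneg (1 - t.z)]
  exact sub_pos.1 h2

theorem irrational_arg (hu : t.u ≠ 0) (h : GoodShape t.z)
    (hirr : Irrational (t.toTile.a / Real.pi)) : Irrational (t.z.arg / Real.pi) := by
  have hz0 := h.ne_zero
  rw [Tile.a, ← pt_zero, ← pt_one, ← pt_z hu, EuclideanGeometry.angle_comm,
    angle_pt hu hz0 one_ne_zero, sub_zero, sub_zero, div_one] at hirr
  rcases abs_choice t.z.arg with h' | h' <;> rw [h'] at hirr
  · exact hirr
  · rw [neg_div] at hirr
    exact hirr.of_neg

end CTile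

end Pinwheel

theorem mainTheorem2 (T : Pinwheel.Tile) (hT : T.Nondegenerate)
    (hac : T.a < T.c) (ha : Irrational (T.a / Real.pi))
    (𝒯 : ℕ → Set Pinwheel.Tile)
    (htil : ∀ i, Pinwheel.IsTiling T (𝒯 i))
    (href : ∀ i, Pinwheel.Refines (𝒯 (i + 1)) (𝒯 i))
    (hdiam : Tendsto (fun i => Pinwheel.maxDiam (𝒯 i)) atTop (𝓝 0))
    (P Q : Pinwheel.Plane) (hP : P ∈ T.boundary) (hQ : Q ∈ T.boundary) :
    Tendsto (fun i => Pinwheel.pathDist (Pinwheel.skeleton (𝒯 i)) P Q) atTop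
      (𝓝 (edist P Q)) := by
  obtain ⟨t, rfl⟩ := Pinwheel.exists_toTile T
  obtain ⟨hu, hz⟩ := Pinwheel.CTile.goodShape_of_toTile hT hac rfl
  have ht : t.InClass t.z := ⟨hu, by simp [Pinwheel.shapes]⟩
  have hirr := Pinwheel.CTile.irrational_arg hu hz ha
  rw [Pinwheel.CTile.boundary_toTile, ← Pinwheel.CTile.sk_zero] at hP hQ
  obtain ⟨X, hX, rfl⟩ := hP
  obtain ⟨Y, hY, rfl⟩ := hQ
  refine tendsto_order.2 ⟨fun b hb => Eventually.of_forall fun i =>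
    hb.trans_le (Pinwheel.edist_le_pathDist _ _ _), fun b hb => ?_⟩
  obtain ⟨ε, hε, hlt⟩ : ∃ ε > 0, ENNReal.ofReal (1 * dist X Y + ε) < b := by
    rw [gt_iff_lt, LinearIsometryEquiv.edist_map, edist_dist] at hb
    obtain ⟨r, hr0, h1, h2⟩ := ENNReal.lt_iff_exists_real_btwn.1 hb
    rw [ENNReal.ofReal_lt_ofReal_iff_of_nonneg dist_nonneg] at h1
    exact ⟨r - dist X Y, sub_pos.2 h1, by rwa [one_mul, add_sub_cancel]⟩
  obtain ⟨m, hm⟩ := Pinwheel.CTile.distortion_one hz hirr t ht 0 X hX Y hY ε hε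
  filter_upwards [Pinwheel.CTile.eventually_sk_subset hz ht htil hdiam m] with i hi
  exact (Pinwheel.pathDist_mono hi _ _).trans_lt
    ((hm.image Pinwheel.toPlane).pathDist_le.trans_lt hlt)
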